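/- Let $q=p^m$ with $p$ an odd prime and $m\in\mathbb N$ such that $4\mid\frac{q-1}{p-1}$, $q\ge 5$ and $q\ne 9$, and put $n=\frac{q-1}{4}$ (which is an even integer). Let $R_4=\{x^4 : x\in\mathbb F_q^*\}$. Let $\Gamma(4,q)$ be the graph with vertex set $\mathbb F_q$ in which $v,w$ are joined if and only if $w-v\in R_4$, and let $\Gamma^+(4,q)$ be the graph with vertex set $\mathbb F_q$ in which $v,w$ are joined if and only if $v+w\in R_4$ (there is a loop at $v$ if $v+v\in R_4$; it contributes $1$ to the diagonal of the adjacency matrix). The spectrum $\mathrm{Spec}$ of a graph is the set of the distinct eigenvalues of its adjacency matrix, written $[\lambda]^e$ with their multiplicities $e$; $[\pm\lambda]^e$ means that $\lambda$ and $-\lambda$ both occur, each with multiplicity $e$. Then $\Gamma^+(4,q)$ is connected with integral spectrum. Its non-principal eigenvalues are $\pm$ those of $\Gamma(4,q)$ with halved multiplicities: if $M^+$ and $M$ are the multisets of eigenvalues of $\Gamma^+(4,q)$ and $\Gamma(4,q)$, each with one copy of the principal eigenvalue $n$ removed, then the multiset $M^+$ taken twice is the multiset sum of $M$ and $-M$.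 Explicitly: (a) If $p\equiv 1\pmod 4$, then $m=4t$ for some $t\in\mathbb N$ and $$\mathrm{Spec}(\Gamma^+(4,q))=\Big\{[n]^1,\ \big[\pm\tfrac{\sqrt q+4d\sqrt[4]{q}-1}{4}\big]^{\frac n2},\ \big[\pm\tfrac{\sqrt q-4d\sqrt[4]{q}-1}{4}\big]^{\frac n2},\ \big[\pm\tfrac{-\sqrt q+2c\sqrt[4]{q}-1}{4}\big]^{\frac n2},\ \big[\pm\tfrac{-\sqrt q-2c\sqrt[4]{q}-1}{4}\big]^{\frac n2}\Big\},$$ where $c,d$ are integers, which exist and are uniquely determined up to the sign of $d$, such that $$\sqrt q=c^2+4d^2,\qquad c\equiv 1\pmod 4,\qquad \gcd(c,p)=1 .$$ (b) If $p\equiv 3\pmod 4$, then $m=2t$ for some $t\in\mathbb N$ and $$\mathrm{Spec}(\Gamma^+(4,q))=\begin{cases}\Big\{[n]^1,\ \big[\pm\tfrac{\sqrt q-1}{4}\big]^{\frac{3n}{2}},\ \big[\pm\tfrac{3\sqrt q+1}{4}\big]^{\frac n2}\Big\} & \text{if } m\equiv 0\pmod 4,\\[2mm] \Big\{[n]^1,\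 \big[\pm\tfrac{\sqrt q+1}{4}\big]^{\frac{3n}{2}},\ \big[\pm\tfrac{3\sqrt q-1}{4}\big]^{\frac n2}\Big\} & \text{if } m\equiv 2\pmod 4.\end{cases}$$ -/

import Mathlib

namespace GPGraph

/-- The Cayley graph `X(G, S)`: there is an arrow from `v` to `w` iff `w - v ∈ S`. -/
def cayley {G : Type*} [AddCommGroup G] (S : Set G) : Digraph G where
  Adj v w := w - v ∈ S

/-- The Cayley sum graph `X⁺(G, S)`: there is an arrow from `v` to `w` iff `v + w ∈ S`.
The relation is always symmetric, and `v` carries a loop iff `v + v ∈ S`. -/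
def cayleySum {G : Type*} [AddCommGroup G] (S : Set G) : Digraph G where
  Adj v w := v + w ∈ S

/-- `R_k`, the set of nonzero `k`-th powers of the field `F`. -/
def powers (k : ℕ) (F : Type*) [Field F] : Set F :=
  {y | ∃ x : F, x ≠ 0 ∧ x ^ k = y}

/-- The generalized Paley graph `Γ(k, q)`, where `F` is the field with `q` elements. -/
def paley (k : ℕ) (F : Type*) [Field F] : Digraph F := cayley (powers k F)

/-- The generalized Paley sum graph `Γ⁺(k, q)`, where `F` is the field with `q` elements. -/
def paleySum (k : ℕ) (F : Type*) [Field F] : Digraph F := cayleySum (powers k F)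

open Classical in
/-- The adjacency matrix: the entry at `(v, w)` is `1` if there is an arrow from `v` to `w`, and
`0` otherwise; a loop contributes `1` on the diagonal. -/
noncomputable def adjMatrix {V : Type*} (Γ : Digraph V) : Matrix V V ℂ :=
  Matrix.of fun v w => if Γ.Adj v w then 1 else 0

open Classical in
/-- The multiset of all eigenvalues of a finite graph, i.e. the complex roots of the characteristic
polynomial of its adjacency matrix, with (algebraic) multiplicity. -/
noncomputable def eigenvalues {V : Type*} [Fintype V] (Γ : Digraph V) : Multiset ℂ :=
  (adjMatrix Γ).charpoly.roots

/-- A graph is connected iff its underlying simple graph (forget loops and directions) is. -/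
def Connected {V : Type*} (Γ : Digraph V) : Prop := Γ.toSimpleGraphInclusive.Connected

/-- All eigenvalues are integers. -/
def HasIntegralSpectrum {V : Type*} [Fintype V] (Γ : Digraph V) : Prop :=
  ∀ μ ∈ eigenvalues Γ, ∃ z : ℤ, μ = (z : ℂ)

/-- `Spec(Γ) = {[λ₁]^{e₁}, …, [λ_s]^{e_s}}` for the list `L` of the pairs `(λᵢ, eᵢ)`: the `λᵢ` are
pairwise distinct reals, the `eᵢ` are positive, and the multiset of all eigenvalues of `Γ` consists
of each `λᵢ` repeated `eᵢ` times. -/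
def HasSpec {V : Type*} [Fintype V] (Γ : Digraph V) (L : List (ℝ × ℕ)) : Prop :=
  (L.map Prod.fst).Nodup ∧ (∀ x ∈ L, 0 < x.2) ∧
    eigenvalues Γ = (L.map fun x => Multiset.replicate x.2 (x.1 : ℂ)).sum

/-- The entry `[± l]^e` of a spectrum: both `l` and `-l` occur with multiplicity `e`. -/
def pm (l : ℝ) (e : ℕ) : List (ℝ × ℕ) := [(l, e), (-l, e)]

/-- The conditions `√q = c² + 4d²`, `c ≡ 1 (mod 4)` and `(c, p) = 1`. -/
def QuarticRep (p q : ℕ) (c d : ℤ) : Prop :=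
  √(q : ℝ) = (c : ℝ) ^ 2 + 4 * (d : ℝ) ^ 2 ∧ c ≡ 1 [ZMOD 4] ∧ IsCoprime c (p : ℤ)

end GPGraph

/-! Additive characters diagonalise `paley 4 F`: the eigenvalue at b is the exponential sum E(b) of
ψ(bs) over s ∈ R₄. The sum graph sends the character ψ_b to E(b)ψ_{-b}. Since R₄ = -R₄ gives E(-b) =
E(b), each pair {b, -b} contributes E(b) and -E(b), which halves the multiplicities.

For b ≠ 0, E(b) depends only on χ(b), χ a quartic character. Expand the indicator of R₄ in powers of
χ and choose ψ so that the quadratic Gauss sum is r = √q: the four values are (r - 1 ± 2A)/4 and (-r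
- 1 ± 2B)/4, where G = A + iB is the quartic Gauss sum and A² + B² = q. They are integers because 4
∣ (q - 1)/(p - 1) puts the nonzero elements of the prime field in R₄ (`exists_int_eq_expSum`); hence
A and B are integers too.

It remains to find A and B. If p ≡ 3 (mod 4), an even power of p is a sum of two squares only
trivially, so A or B vanishes, and r mod 4 decides which. If p ≡ 1 (mod 4), then G² = r·J(χ,χ) with
p ∤ J(χ,χ) (`not_dvd_jacobiSum`, via Lucas), so G is the fourth root of q times a Gaussian integer
not divisible by p. Its norm gives √q = c² + 4d², a primitive representation unique up to signs
(`sq_eq_sq_of_primitive_rep`). -/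

open Finset

namespace GPGraph

/-! ### Eigenvalues of Cayley graphs and Cayley sum graphs by additive characters -/

section Spectral

lemma charpoly_roots_of_mul_eq {V : Type*} [Fintype V] [DecidableEq V] {M W : Matrix V V ℂ}
    {l : V → ℂ} (hW : IsUnit W) (h : M * W = W * Matrix.diagonal l) :
    M.charpoly.roots = univ.val.map l := by
  obtain ⟨u, rfl⟩ := hW
  have hM : M = u * Matrix.diagonal l * (u⁻¹ : (Matrix V V ℂ)ˣ) := by
    rw [← h, mul_assoc, Units.mul_inv, mul_one]
  rw [hM, Matrix.charpoly_mul_comm, ← mul_assoc, Units.inv_mul, one_mul, Matrix.charpoly_diagonal, Polynomial.roots_prod]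
  · simp
  · exact Finset.prod_ne_zero_iff.2 fun i _ => Polynomial.X_sub_C_ne_zero _

variable {F : Type*} [Field F] [Fintype F]

/-- The exponential sum `∑_{s ∈ S} ψ(bs)`. -/
noncomputable def expSum (S : Set F) (ψ : AddChar F ℂ) (b : F) : ℂ :=
  ∑ x : F, S.indicator (fun x => ψ (b * x)) x

lemma expSum_neg {S : Set F} (hS : ∀ x, -x ∈ S ↔ x ∈ S) (ψ : AddChar F ℂ) (b : F) :
    expSum S ψ (-b) = expSum S ψ b := by
  unfold expSum
  rw [← Equiv.sum_comp (Equiv.neg F)]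
  refine sum_congr rfl fun x _ => ?_
  by_cases hx : x ∈ S
  · simp [Set.indicator, hx, hS]
  · simp [Set.indicator, hx, hS]

/-- The matrix whose columns are the additive characters of `F`. -/
def charMatrix (ψ : AddChar F ℂ) : Matrix F F ℂ := Matrix.of fun v b => ψ (b * v)

lemma isUnit_charMatrix [DecidableEq F] {ψ : AddChar F ℂ} (hψ : ψ.IsPrimitive) :
    IsUnit (charMatrix ψ) := by
  have hq : (Fintype.card F : ℂ) ≠ 0 := by simp
  have h : charMatrix ψ * ((Fintype.card F : ℂ)⁻¹ • Matrix.of fun b v => ψ (b * -v)) = 1 := by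
    ext v w
    have := AddChar.sum_mulShift (v - w) hψ
    rw [Matrix.mul_smul, Matrix.smul_apply, Matrix.mul_apply]
    simp only [charMatrix, Matrix.of_apply, ← AddChar.map_add_eq_mul, ← mul_add,
      ← sub_eq_add_neg]
    rw [this, Matrix.one_apply]
    simp only [sub_eq_zero]
    split_ifs <;> simp
  exact isUnit_iff_exists_inv.2 ⟨_, h⟩

lemma adjMatrix_cayley_mul (S : Set F) (ψ : AddChar F ℂ) [DecidableEq F] :
    adjMatrix (cayley S) * charMatrix ψ = charMatrix ψ * Matrix.diagonal (expSum S ψ) := by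
  ext v b
  rw [Matrix.mul_apply, Matrix.mul_diagonal, expSum, mul_sum,
    ← Equiv.sum_comp (Equiv.addRight v)]
  refine sum_congr rfl fun x _ => ?_
  by_cases hx : x ∈ S
  · simp [adjMatrix, cayley, charMatrix, hx, mul_add, AddChar.map_add_eq_mul, mul_comm]
  · simp [adjMatrix, cayley, charMatrix, hx]

lemma adjMatrix_cayleySum_mul (S : Set F) (ψ : AddChar F ℂ) [DecidableEq F] (v b : F) :
    (adjMatrix (cayleySum S) * charMatrix ψ) v b = ψ (-b * v) * expSum S ψ b := by
  rw [Matrix.mul_apply, expSum, mul_sum, ← Equiv.sum_comp (Equiv.subRight v)]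
  refine sum_congr rfl fun x _ => ?_
  by_cases hx : x ∈ S
  · simp [adjMatrix, cayleySum, charMatrix, hx, ← AddChar.map_add_eq_mul]
    congr 1; ring
  · simp [adjMatrix, cayleySum, charMatrix, hx]

lemma eigenvalues_cayley (S : Set F) {ψ : AddChar F ℂ} (hψ : ψ.IsPrimitive) :
    eigenvalues (cayley S) = univ.val.map (expSum S ψ) := by
  classical
  unfold eigenvalues
  convert charpoly_roots_of_mul_eq (isUnit_charMatrix hψ) (adjMatrix_cayley_mul S ψ)

/-- The sign decides which of b, -b receives E(b) and which -E(b); any embedding of F in ℤ orders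
each such pair. -/
lemma exists_odd_sign (hF : ringChar F ≠ 2) :
    ∃ θ : F → ℤ, θ 0 = 0 ∧ (∀ b, θ (-b) = -θ b) ∧ ∀ b, b ≠ 0 → θ b = 1 ∨ θ b = -1 := by
  let e : F ↪ ℤ := (Fintype.equivFin F).toEmbedding.trans
    (Fin.valEmbedding.trans Nat.castEmbedding)
  refine ⟨fun b => SignType.sign (e b - e (-b)), by simp, fun b => ?_, fun b hb => ?_⟩
  · beta_reduce
    rw [neg_neg, ← neg_sub (e b), Left.sign_neg]; simp
  · have : e b - e (-b) ≠ 0 := fun h => hb <| by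
      have h1 : b = -b := e.injective (sub_eq_zero.1 h)
      exact (Ring.eq_self_iff_eq_zero_of_char_ne_two hF).1 h1.symm
    rcases lt_or_gt_of_ne this with h | h
    · right; simp [sign_neg h]
    · left; simp [sign_pos h]

/-- The eigenvalues of a Cayley sum graph with symmetric connection set. -/
lemma eigenvalues_cayleySum {S : Set F} (hS : ∀ x, -x ∈ S ↔ x ∈ S) {ψ : AddChar F ℂ}
    (hψ : ψ.IsPrimitive) {θ : F → ℤ} (h0 : θ 0 = 0) (hneg : ∀ b, θ (-b) = -θ b)
    (hθ : ∀ b, b ≠ 0 → θ b = 1 ∨ θ b = -1) [DecidableEq F] :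
    eigenvalues (cayleySum S) =
      univ.val.map fun b => if b = 0 then expSum S ψ 0 else θ b * expSum S ψ b := by
  -- Column b of `charMatrix ψ * (1 + T)` is ψ_b + θ(b)ψ_{-b}. For b ≠ 0, θ(b)² = 1 makes it an
  -- eigenvector with eigenvalue θ(b)E(b).
  let T : Matrix F F ℂ := Matrix.of fun a b => if a = -b then (θ b : ℂ) else 0
  have hcol : ∀ (A : Matrix F F ℂ) (v b : F), (A * T) v b = θ b * A v (-b) := by
    intro A v b
    simp [Matrix.mul_apply, T, mul_comm]
  have hT : IsUnit (1 + T) := by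
    -- As θ is odd, T² is diagonal, with entry -1 off 0 and 0 at 0.
    have h1 : (1 + T) * (1 - T) = Matrix.diagonal fun b : F => if b = 0 then (1 : ℂ) else 2 := by
      have : (1 + T) * (1 - T) = 1 - T * T := by noncomm_ring
      rw [this]
      ext a b
      rw [Matrix.sub_apply, hcol, Matrix.one_apply, Matrix.diagonal_apply]
      by_cases hb : b = 0
      · subst hb
        simp only [h0]
        split_ifs <;> simp_all
      · rcases hθ b hb with h | h <;>
        · by_cases hab : a = b
          · simp [T, hneg, h, hab, hb]; norm_num
          · simp [T, hab]
    have h2 : IsUnit (Matrix.diagonal fun b : F => if b = 0 then (1 : ℂ) else 2) := by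
      rw [Matrix.isUnit_iff_isUnit_det, Matrix.det_diagonal, isUnit_iff_ne_zero]
      exact prod_ne_zero_iff.2 fun b _ => by split_ifs <;> norm_num
    rw [← h1] at h2
    rw [Matrix.isUnit_iff_isUnit_det, Matrix.det_mul] at *
    exact isUnit_of_mul_isUnit_left h2
  unfold eigenvalues
  convert charpoly_roots_of_mul_eq ((isUnit_charMatrix hψ).mul hT) ?_
  ext v b
  rw [← mul_assoc, Matrix.mul_add, Matrix.mul_add, Matrix.add_mul, Matrix.add_apply,
    Matrix.add_apply, hcol, Matrix.mul_diagonal, Matrix.mul_diagonal, hcol, mul_one, mul_one,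
    adjMatrix_cayleySum_mul, adjMatrix_cayleySum_mul, expSum_neg hS, neg_neg]
  by_cases hb : b = 0
  · subst hb; simp [h0, charMatrix]
  · rcases hθ b hb with h | h <;> simp [h, hb, charMatrix] <;> ring

end Spectral

/-! ### A quartic character with values in ℤ[i] and its reduction mod p -/

section QuarticCharacter

lemma gaussianInt_I_pow_eq_one_iff (j : ℕ) : (⟨0, 1⟩ : GaussianInt) ^ j = 1 ↔ 4 ∣ j := by
  have h4 : (⟨0, 1⟩ : GaussianInt) ^ 4 = 1 := by decide
  have hlt : j % 4 < 4 := Nat.mod_lt _ (by norm_num)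
  conv_lhs => rw [← Nat.div_add_mod j 4, pow_add, pow_mul, h4, one_pow, one_mul]
  rw [Nat.dvd_iff_mod_eq_zero]
  generalize j % 4 = r at hlt
  interval_cases r <;> decide

variable {F : Type*} [Field F] [Fintype F]

/-- The map f is reduction modulo a prime above p. The exponent 3k, rather than k, is chosen for the
Jacobi sum: ∑ x^k (1 - x)^k has degree 2k < q - 1 and vanishes, while 3k leaves a binomial
coefficient. -/
theorem exists_quarticChar {k : ℕ} (hq : Fintype.card F = 4 * k + 1) (hk : 0 < k) :
    ∃ (g : F) (χ : MulChar F GaussianInt) (f : GaussianInt →+* F), g ≠ 0 ∧ χ g = ⟨0, 1⟩ ∧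
      (∀ x, x ≠ 0 → (χ x = 1 ↔ x ∈ powers 4 F)) ∧ (∀ x, x ≠ 0 → (χ x = 1 ↔ x ^ k = 1)) ∧
      ∀ x, f (χ x) = x ^ (3 * k) := by
  classical
  obtain ⟨g, hg⟩ := IsCyclic.exists_generator (α := Fˣ)
  have hcard : Fintype.card Fˣ = 4 * k := by rw [Fintype.card_units, hq]; rfl
  have hord : orderOf g = 4 * k := by
    rw [orderOf_eq_card_of_forall_mem_zpowers hg, Nat.card_eq_fintype_card, hcard]
  have hgen : ∀ x : F, x ≠ 0 → ∃ j : ℕ, x = (g : F) ^ j := fun x hx => by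
    obtain ⟨j, hj⟩ := (Submonoid.mem_powers_iff _ _).1
      ((mem_powers_iff_mem_zpowers).2 (hg (Units.mk0 x hx)))
    exact ⟨j, by simpa using (congrArg Units.val hj).symm⟩
  let i : GaussianIntˣ := ⟨⟨0, 1⟩, ⟨0, -1⟩, by decide, by decide⟩
  have hi : i ∈ rootsOfUnity (Fintype.card Fˣ) GaussianInt := by
    rw [mem_rootsOfUnity, hcard]
    ext1
    simpa using (gaussianInt_I_pow_eq_one_iff (4 * k)).2 ⟨k, rfl⟩
  let χ : MulChar F GaussianInt := MulChar.ofRootOfUnity hi hg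
  have hχg : χ g = ⟨0, 1⟩ := MulChar.ofRootOfUnity_spec hi hg
  have hgpow : ∀ j, (g : F) ^ j = 1 ↔ 4 * k ∣ j := fun j => by
    rw [← hord, orderOf_dvd_iff_pow_eq_one, Units.ext_iff]; simp
  have hg2 : (g : F) ^ (2 * k) = -1 := by
    have h1 : ((g : F) ^ (2 * k)) ^ 2 = 1 := by
      rw [← pow_mul, hgpow]; exact ⟨1, by ring⟩
    refine (mul_self_eq_one_iff.1 (by rw [← sq, h1])).resolve_left ?_
    rw [hgpow]
    intro h
    have := Nat.le_of_dvd (by omega) h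
    omega
  have hf : (g : F) ^ (3 * k) * (g : F) ^ (3 * k) = ((-1 : ℤ) : F) := by
    rw [← pow_add, show 3 * k + 3 * k = 2 * k * 3 by ring, pow_mul, hg2]; norm_num
  have hχ1 : ∀ j, χ ((g : F) ^ j) = 1 ↔ 4 ∣ j := fun j => by
    rw [map_pow, hχg, gaussianInt_I_pow_eq_one_iff]
  refine ⟨g, χ, Zsqrtd.lift ⟨(g : F) ^ (3 * k), hf⟩, g.ne_zero, hχg, fun x hx => ?_,
    fun x hx => ?_, fun x => ?_⟩
  · constructor
    · obtain ⟨j, rfl⟩ := hgen x hx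
      rw [hχ1]
      rintro ⟨l, rfl⟩
      exact ⟨(g : F) ^ l, pow_ne_zero _ g.ne_zero, by rw [← pow_mul, mul_comm]⟩
    · rintro ⟨y, hy, rfl⟩
      obtain ⟨j, rfl⟩ := hgen y hy
      rw [← pow_mul, hχ1]
      exact ⟨j, mul_comm _ _⟩
  · obtain ⟨j, rfl⟩ := hgen x hx
    rw [hχ1, ← pow_mul, hgpow]
    exact (Nat.mul_dvd_mul_iff_right hk).symm
  · by_cases hx : x = 0
    · subst hx
      rw [MulChar.map_zero, map_zero, zero_pow (by omega)]
    · obtain ⟨j, rfl⟩ := hgen x hx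
      rw [map_pow, map_pow, hχg]
      simp [Zsqrtd.lift]
      ring

end QuarticCharacter

/-! ### Gaussian periods: integrality and expression by Gauss sums -/

section Periods

variable {F : Type*} [Field F] [Fintype F]

lemma pow_four_eq_one_cases {z : GaussianInt} (h : z ^ 4 = 1) :
    z = 1 ∨ z = -1 ∨ z = ⟨0, 1⟩ ∨ z = -⟨0, 1⟩ := by
  have hi : (⟨0, 1⟩ : GaussianInt) * ⟨0, 1⟩ = -1 := by decide
  have h1 : (z - 1) * (z + 1) * ((z - ⟨0, 1⟩) * (z + ⟨0, 1⟩)) = 0 := by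
    have : (z - ⟨0, 1⟩) * (z + ⟨0, 1⟩) = z ^ 2 + 1 := by linear_combination -hi
    rw [this]
    linear_combination h
  rcases mul_eq_zero.1 h1 with h | h <;> rcases mul_eq_zero.1 h with h | h
  · exact .inl (sub_eq_zero.1 h)
  · exact .inr (.inl (eq_neg_of_add_eq_zero_left h))
  · exact .inr (.inr (.inl (sub_eq_zero.1 h)))
  · exact .inr (.inr (.inr (eq_neg_of_add_eq_zero_left h)))

lemma expSum_eq_mulShift (S : Set F) (ψ : AddChar F ℂ) (b c : F) :
    expSum S (ψ.mulShift c) b = expSum S ψ (c * b) := by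
  simp [expSum, AddChar.mulShift_apply, mul_assoc]

lemma mul_mem_powers_iff {F : Type*} [Field F] {n : ℕ} {c x : F} (hc : c ∈ powers n F) :
    c * x ∈ powers n F ↔ x ∈ powers n F := by
  obtain ⟨y, hy, rfl⟩ := hc
  constructor
  · rintro ⟨z, hz, h⟩
    refine ⟨y⁻¹ * z, by simp [hy, hz], ?_⟩
    rw [mul_pow, h, ← mul_assoc, ← mul_pow, inv_mul_cancel₀ hy, one_pow, one_mul]
  · rintro ⟨z, hz, rfl⟩
    exact ⟨y * z, mul_ne_zero hy hz, mul_pow _ _ _⟩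

lemma expSum_powers_mul {n : ℕ} (ψ : AddChar F ℂ) {c : F} (hc : c ∈ powers n F) (b : F) :
    expSum (powers n F) ψ (c * b) = expSum (powers n F) ψ b := by
  have hc0 : c ≠ 0 := by
    obtain ⟨y, hy, rfl⟩ := hc
    exact pow_ne_zero _ hy
  unfold expSum
  rw [← Equiv.sum_comp (Equiv.mulLeft₀ c hc0) fun x =>
    (powers n F).indicator (fun x => ψ (b * x)) x]
  refine sum_congr rfl fun x _ => ?_
  change _ = (powers n F).indicator (fun x => ψ (b * x)) (c * x)
  by_cases hx : x ∈ powers n F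
  · rw [Set.indicator_of_mem hx, Set.indicator_of_mem ((mul_mem_powers_iff hc).2 hx),
      mul_comm c b, mul_assoc]
  · rw [Set.indicator_of_notMem hx, Set.indicator_of_notMem (mt (mul_mem_powers_iff hc).1 hx)]

lemma expSum_zero_right (S : Set F) (ψ : AddChar F ℂ) : expSum S ψ 0 = S.ncard := by
  classical
  simp [expSum, Set.indicator, Set.ncard_eq_toFinset_card']

lemma isIntegral_expSum (S : Set F) (ψ : AddChar F ℂ) (b : F) : IsIntegral ℤ (expSum S ψ b) := by
  refine IsIntegral.sum _ fun x _ => ?_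
  by_cases hx : x ∈ S
  · rw [Set.indicator_of_mem hx]
    refine IsIntegral.of_pow (n := Fintype.card F) Fintype.card_pos ?_
    rw [← AddChar.map_nsmul_eq_pow, card_nsmul_eq_zero, AddChar.map_zero_eq_one]
    exact isIntegral_one
  · rw [Set.indicator_of_notMem hx]
    exact isIntegral_zero

lemma exists_int_of_isIntegral_of_mul {z : ℂ} (hz : IsIntegral ℤ z) {a b : ℤ} (ha : a ≠ 0)
    (h : a * z = b) : ∃ c : ℤ, z = c := by
  have ha' : (a : ℂ) ≠ 0 := by exact_mod_cast ha
  have hz' : z = algebraMap ℚ ℂ ((b : ℚ) / a) := by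
    rw [eq_ratCast]; push_cast; field_simp; rw [← h]; ring
  rw [hz', isIntegral_algebraMap_iff (algebraMap ℚ ℂ).injective] at hz
  obtain ⟨c, hc⟩ := IsIntegrallyClosed.isIntegral_iff.1 hz
  exact ⟨c, by rw [hz', ← hc]; simp⟩

/-- Gaussian periods are integers as soon as the prime field consists of `n`-th powers. -/
lemma exists_int_eq_expSum {n p : ℕ} [hp : Fact p.Prime] [CharP F p]
    (hprime : ∀ a : ℕ, (a : F) ≠ 0 → (a : F) ∈ powers n F) (ψ : AddChar F ℂ) (b : F) :
    ∃ z : ℤ, expSum (powers n F) ψ b = z := by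
  -- For each x the values ψ(bx)^a, 0 ≤ a < p, are the powers of a p-th root of unity, so they sum
  -- to p or 0. In the total, a = 0 gives |R_n| and the other p - 1 terms all equal E(b); thus E(b)
  -- is a rational algebraic integer.
  have key : ∃ N : ℤ, ∑ a ∈ range p, expSum (powers n F) ψ (a * b) = N := by
    unfold expSum
    rw [sum_comm]
    have : ∀ x : F, ∃ N : ℤ,
        ∑ a ∈ range p, (powers n F).indicator (fun x => ψ (a * b * x)) x = N := fun x => by
      by_cases hx : x ∈ powers n F
      · have hpow : ∀ a : ℕ, ψ (a * b * x) = ψ (b * x) ^ a := fun a => by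
          rw [← AddChar.map_nsmul_eq_pow, nsmul_eq_mul, mul_assoc]
        simp only [Set.indicator_of_mem hx, hpow]
        by_cases h1 : ψ (b * x) = 1
        · exact ⟨p, by simp [h1]⟩
        · refine ⟨0, ?_⟩
          rw [geom_sum_eq h1, ← AddChar.map_nsmul_eq_pow, nsmul_eq_mul, CharP.cast_eq_zero]
          simp
      · exact ⟨0, by simp [Set.indicator_of_notMem hx]⟩
    choose N hN using this
    exact ⟨∑ x, N x, by push_cast; exact sum_congr rfl fun x _ => hN x⟩
  obtain ⟨N, hN⟩ := key
  rw [← Nat.sub_add_cancel hp.out.one_le, sum_range_succ', Nat.cast_zero, zero_mul,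
    expSum_zero_right] at hN
  have hterm : ∀ a ∈ range (p - 1), expSum (powers n F) ψ ((a + 1 : ℕ) * b) =
      expSum (powers n F) ψ b := fun a ha => by
    refine expSum_powers_mul ψ (hprime _ ?_) b
    rw [Ne, CharP.cast_eq_zero_iff F p]
    intro hdvd
    have := Nat.le_of_dvd (by omega) hdvd
    have := mem_range.1 ha
    omega
  rw [sum_congr rfl hterm, sum_const, card_range, nsmul_eq_mul] at hN
  refine exists_int_of_isIntegral_of_mul (isIntegral_expSum _ ψ b) (a := (p - 1 : ℕ))
    (b := N - (powers n F).ncard) ?_ ?_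
  · have := hp.out.two_le
    omega
  · push_cast at hN ⊢
    rw [← hN]; ring

/-- Four times the indicator function of fourth powers is the sum of the powers of a quartic
character. -/
lemma four_mul_expSum {χ : MulChar F GaussianInt}
    (hχ : ∀ x, x ≠ 0 → (χ x = 1 ↔ x ∈ powers 4 F)) {ψ : AddChar F ℂ} (hψ : ψ ≠ 1) :
    4 * expSum (powers 4 F) ψ 1 =
      -1 + gaussSum ((χ.ringHomComp GaussianInt.toComplex) ^ 2) ψ +
        gaussSum (χ.ringHomComp GaussianInt.toComplex) ψ +
        gaussSum ((χ.ringHomComp GaussianInt.toComplex) ^ 3) ψ := by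
  classical
  -- Off 0 the indicator is (1 + χ + χ² + χ³)/4; the sum of ψ over x ≠ 0 is -1.
  have h0 : (-1 : ℂ) = ∑ x, (ψ x - if x = 0 then 1 else 0) := by
    rw [sum_sub_distrib, AddChar.sum_eq_zero_of_ne_one hψ]; simp
  rw [h0, expSum, mul_sum, gaussSum, gaussSum, gaussSum, ← sum_add_distrib, ← sum_add_distrib,
    ← sum_add_distrib]
  refine sum_congr rfl fun x _ => ?_
  by_cases hx : x = 0
  · have : (0 : F) ∉ powers 4 F := by
      rintro ⟨y, hy, h⟩
      exact pow_ne_zero _ hy h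
    subst hx
    simp only [Set.indicator_of_notMem this, MulChar.map_zero]
    simp
  have hx4 : χ x ^ 4 = 1 := by
    rw [← map_pow, hχ _ (pow_ne_zero _ hx)]
    exact ⟨x, hx, rfl⟩
  simp only [MulChar.pow_apply' _ two_ne_zero, MulChar.pow_apply' _ three_ne_zero,
    MulChar.ringHomComp_apply, one_mul, if_neg hx, sub_zero]
  have hI := Complex.I_sq
  have hI3 : Complex.I ^ 3 = -Complex.I := by rw [pow_succ, hI]; ring
  by_cases h1 : χ x = 1
  · rw [Set.indicator_of_mem ((hχ x hx).1 h1), h1, map_one]; ring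
  · rw [Set.indicator_of_notMem (mt (hχ x hx).2 h1)]
    rcases pow_four_eq_one_cases hx4 with h | h | h | h
    · exact absurd h h1
    all_goals
      simp [h, GaussianInt.toComplex_def]
    all_goals
      ring_nf <;> simp [hI3]

variable {χ : MulChar F GaussianInt}

/-- The Gauss sum attached to a Gaussian-integer-valued character. -/
noncomputable def quarticGaussSum (χ : MulChar F GaussianInt) (ψ : AddChar F ℂ) : ℂ :=
  gaussSum (χ.ringHomComp GaussianInt.toComplex) ψ

/-- For a suitable additive character, the quadratic Gauss sum is the positive root of `#F`. -/
lemma exists_gaussSum_sq_eq {r : ℕ} (hq : Fintype.card F = r ^ 2) {g : F} (hg : g ≠ 0)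
    (hχg : χ g = ⟨0, 1⟩) (hneg : χ (-1) = 1) (hχ4 : χ ^ 4 = 1) :
    ∃ ψ : AddChar F ℂ, ψ.IsPrimitive ∧
      gaussSum ((χ.ringHomComp GaussianInt.toComplex) ^ 2) ψ = r := by
  set φ := χ.ringHomComp GaussianInt.toComplex with hφ
  obtain ⟨ψ, hψ⟩ : ∃ ψ : AddChar F ℂ, ψ.IsPrimitive := by
    obtain ⟨ψ, hψ⟩ := AddChar.exists_apply_ne_zero.2 (one_ne_zero (α := F))
    exact ⟨ψ, AddChar.IsPrimitive.of_ne_one fun h => hψ (by rw [h, AddChar.one_apply])⟩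
  have hφg : (φ ^ 2) g = -1 := by
    rw [MulChar.pow_apply' _ two_ne_zero, hφ, MulChar.ringHomComp_apply, hχg]
    simp [GaussianInt.toComplex_def]
  have hφ4 : φ ^ 4 = 1 := by
    rw [hφ, MulChar.ringHomComp_pow, hχ4, MulChar.ringHomComp_one]
  have hne : φ ^ 2 ≠ 1 := by
    intro h
    rw [h, MulChar.one_apply hg.isUnit] at hφg
    norm_num at hφg
  have hquad : (φ ^ 2).IsQuadratic := by
    intro x
    by_cases hx : x = 0
    · left; rw [hx, MulChar.map_zero]
    · right
      refine mul_self_eq_one_iff.1 ?_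
      rw [← MulChar.mul_apply, ← pow_add, hφ4, MulChar.one_apply (Ne.isUnit hx)]
  have hsq := gaussSum_sq hne hquad hψ
  rw [MulChar.pow_apply' _ two_ne_zero, hφ, MulChar.ringHomComp_apply, hneg, ← hφ, map_one,
    one_pow, one_mul, hq, Nat.cast_pow] at hsq
  rcases sq_eq_sq_iff_eq_or_eq_neg.1 hsq with h | h
  · exact ⟨ψ, hψ, h⟩
  -- Shifting by g multiplies the quadratic Gauss sum by χ²(g) = -1, which corrects the sign.
  · refine ⟨ψ.mulShift g, AddChar.IsPrimitive.of_ne_one (hψ hg), ?_⟩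
    have := gaussSum_mulShift (φ ^ 2) ψ (Units.mk0 g hg)
    rw [Units.val_mk0, hφg, h] at this
    linear_combination -this

/-- Replacing ψ by its shift by b multiplies the Gauss sum of χ^j by the conjugate of χ^j(b), and
χ(-1) = 1 makes the Gauss sum of χ³ = χ⁻¹ the conjugate of that of χ. -/
lemma four_mul_expSum_eq {r : ℕ}
    (hχ : ∀ x, x ≠ 0 → (χ x = 1 ↔ x ∈ powers 4 F)) (hneg : χ (-1) = 1) (hχ4 : χ ^ 4 = 1)
    {ψ : AddChar F ℂ} (hψ : ψ.IsPrimitive)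
    (hr : gaussSum ((χ.ringHomComp GaussianInt.toComplex) ^ 2) ψ = r) {b : F} (hb : b ≠ 0) :
    4 * expSum (powers 4 F) ψ b = -1 + (GaussianInt.toComplex (χ b)) ^ 2 * r +
      star (GaussianInt.toComplex (χ b)) * quarticGaussSum χ ψ +
      GaussianInt.toComplex (χ b) * star (quarticGaussSum χ ψ) := by
  set φ := χ.ringHomComp GaussianInt.toComplex with hφ
  have hφ4 : φ ^ 4 = 1 := by
    rw [hφ, MulChar.ringHomComp_pow, hχ4, MulChar.ringHomComp_one]
  have hinv3 : φ ^ 3 = φ⁻¹ := (inv_eq_of_mul_eq_one_right (by rw [← pow_succ', hφ4])).symm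
  have hinv2 : (φ ^ 2)⁻¹ = φ ^ 2 := inv_eq_of_mul_eq_one_right (by rw [← pow_add, hφ4])
  have hstar : star (gaussSum φ ψ) = gaussSum φ⁻¹ ψ := by
    rw [star_gaussSum_eq, ← mul_gaussSum_inv_eq_gaussSum φ⁻¹ ψ, ← hinv3,
      MulChar.pow_apply' _ three_ne_zero, hφ, MulChar.ringHomComp_apply, hneg]
    simp
  have h := four_mul_expSum hχ (hψ hb)
  rw [expSum_eq_mulShift, mul_one, ← hφ] at h
  have hu := fun φ' : MulChar F ℂ => gaussSum_mulShift_eq φ' ψ (Units.mk0 b hb)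
  simp only [Units.val_mk0] at hu
  rw [h, hu, hu, hu, hinv2, hinv3, inv_inv, hr, ← hstar, MulChar.star_apply' φ b |>.symm,
    MulChar.pow_apply' _ two_ne_zero]
  rfl

lemma norm_quarticGaussSum {g : F} (hg : g ≠ 0) (hχg : χ g = ⟨0, 1⟩) {ψ : AddChar F ℂ}
    (hψ : ψ.IsPrimitive) :
    quarticGaussSum χ ψ * star (quarticGaussSum χ ψ) = Fintype.card F := by
  rw [quarticGaussSum, star_gaussSum_eq]
  refine gaussSum_mul_gaussSum_eq_card (fun h => ?_) hψ
  have := congrArg (fun f : MulChar F ℂ => f g) h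
  simp only [MulChar.ringHomComp_apply, hχg, MulChar.one_apply hg.isUnit] at this
  simpa [GaussianInt.toComplex_def] using congrArg Complex.re this

lemma quarticGaussSum_sq {r : ℕ} {g : F} (hg : g ≠ 0) (hχg : χ g = ⟨0, 1⟩) {ψ : AddChar F ℂ}
    (hr : gaussSum ((χ.ringHomComp GaussianInt.toComplex) ^ 2) ψ = r) :
    quarticGaussSum χ ψ ^ 2 = r * GaussianInt.toComplex (jacobiSum χ χ) := by
  set φ := χ.ringHomComp GaussianInt.toComplex with hφ
  have hne : φ * φ ≠ 1 := by
    intro h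
    have := congrArg (fun f : MulChar F ℂ => f g) h
    simp only [hφ, MulChar.mul_apply, MulChar.ringHomComp_apply, hχg,
      MulChar.one_apply hg.isUnit] at this
    simp [GaussianInt.toComplex_def] at this
    norm_num at this
  have := jacobiSum_mul_nontrivial hne ψ
  rw [← sq, hr, hφ, jacobiSum_ringHomComp, ← hφ] at this
  rw [this, sq]
  rfl

end Periods

/-! ### Jacobi sums modulo p and sums of two squares -/

section NumberTheory

/-- In base p, all m digits of k are e and those of 3k are 3e < p, so Lucas gives C(3k, k) ≡ C(3e,
e)^m. -/
lemma not_dvd_choose_three_mul {p : ℕ} [hp : Fact p.Prime] {e : ℕ} (he : p = 4 * e + 1) (m k : ℕ)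
    (hk : 4 * k + 1 = p ^ m) : ¬ p ∣ (3 * k).choose k := by
  induction m generalizing k with
  | zero =>
    have : k = 0 := by rw [pow_zero] at hk; omega
    subst this
    simpa using hp.out.one_lt.ne'
  | succ m ih =>
    obtain ⟨l, hl⟩ : ∃ l, 4 * l + 1 = p ^ m := by
      have : p ^ m % 4 = 1 := by rw [Nat.pow_mod, he]; simp [Nat.add_mod]
      exact ⟨p ^ m / 4, by omega⟩
    have hkl : k = e + p * l := by
      rw [pow_succ, ← hl] at hk
      have : 4 * k + 1 = 4 * (e + p * l) + 1 := by rw [hk]; nlinarith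
      omega
    have h3 : 3 * k = 3 * e + p * (3 * l) := by rw [hkl]; ring
    have hmod : (3 * k).choose k ≡ (3 * e).choose e * (3 * l).choose l [MOD p] := by
      have := Choose.choose_modEq_choose_mod_mul_choose_div_nat (n := 3 * k) (k := k) (p := p)
      rwa [h3, hkl, Nat.add_mul_mod_self_left, Nat.add_mul_mod_self_left,
        Nat.add_mul_div_left _ _ hp.out.pos, Nat.add_mul_div_left _ _ hp.out.pos,
        Nat.mod_eq_of_lt (by omega), Nat.mod_eq_of_lt (by omega), Nat.div_eq_of_lt (by omega),
        Nat.div_eq_of_lt (by omega), zero_add, zero_add, ← h3, ← hkl] at this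
    rw [hmod.dvd_iff dvd_rfl, hp.out.dvd_mul, not_or]
    refine ⟨fun h => ?_, ih l hl⟩
    have h1 : p ∣ (3 * e).factorial := by
      rw [← Nat.choose_mul_factorial_mul_factorial (show e ≤ 3 * e by omega), mul_assoc]
      exact h.mul_right _
    have := (hp.out.dvd_factorial).1 h1
    omega

variable {F : Type*} [Field F] [Fintype F]

/-- `∑ x, x ^ (3k) (1 - x) ^ (3k)` over the field with `4k + 1` elements. -/
lemma sum_pow_mul_one_sub_pow {k : ℕ} (hq : Fintype.card F = 4 * k + 1) (hk : 0 < k) :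
    ∑ x : F, x ^ (3 * k) * (1 - x) ^ (3 * k) = -((-1) ^ k * ((3 * k).choose k : F)) := by
  classical
  have hpow : ∀ i, 0 < i → ∑ x : F, x ^ i = if 4 * k ∣ i then -1 else 0 := fun i hi => by
    have h := FiniteField.sum_pow_units F i
    rw [hq, Nat.add_sub_cancel] at h
    rw [← h, ← add_sum_erase _ _ (mem_univ (0 : F)), zero_pow hi.ne', zero_add]
    symm
    refine sum_bij' (fun u _ => (u : F))
      (fun x hx => Units.mk0 x (ne_of_mem_erase hx)) ?_ ?_ ?_ ?_ ?_ <;> simp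
  have hexp : ∀ x : F, x ^ (3 * k) * (1 - x) ^ (3 * k) =
      ∑ j ∈ range (3 * k + 1), (-1) ^ j * ((3 * k).choose j : F) * x ^ (3 * k + j) := fun x => by
    rw [sub_eq_neg_add, add_pow, mul_sum]
    refine sum_congr rfl fun j _ => ?_
    rw [neg_pow, pow_add, one_pow]
    ring
  simp_rw [hexp]
  -- The exponent 3k + j lies between 3k and 6k, so 4k divides it only for j = k.
  rw [sum_comm, sum_eq_single k]
  · rw [← mul_sum, hpow _ (by omega), if_pos ⟨1, by ring⟩]; ring
  · intro j hj hjk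
    rw [← mul_sum, hpow _ (by omega), if_neg, mul_zero]
    rintro ⟨c, hc⟩
    have hj' := mem_range.1 hj
    have h0 : 0 < c := by
      rcases Nat.eq_zero_or_pos c with rfl | h
      · omega
      · exact h
    have h2 : c < 2 := by
      by_contra h
      have : 4 * k * 2 ≤ 4 * k * c := Nat.mul_le_mul_left _ (by omega)
      omega
    have : c = 1 := by omega
    subst this
    omega
  · intro h
    exact absurd (mem_range.2 (by omega)) h

/-- The map f kills p but sends the Jacobi sum to ± C(3k, k), a unit of F. -/
lemma not_dvd_jacobiSum {p m k e : ℕ} [hp : Fact p.Prime] [CharP F p] (he : p = 4 * e + 1)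
    (hq : Fintype.card F = 4 * k + 1) (hqm : Fintype.card F = p ^ m) (hk : 0 < k)
    {χ : MulChar F GaussianInt} {f : GaussianInt →+* F} (hf : ∀ x, f (χ x) = x ^ (3 * k)) :
    ¬ (p : GaussianInt) ∣ jacobiSum χ χ := by
  rintro ⟨z, hz⟩
  have h1 := congrArg f hz
  rw [map_mul, map_natCast, CharP.cast_eq_zero, zero_mul, jacobiSum, map_sum] at h1
  simp only [map_mul, hf] at h1
  rw [sum_pow_mul_one_sub_pow hq hk, neg_eq_zero, mul_eq_zero] at h1
  rcases h1 with h1 | h1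
  · exact pow_ne_zero _ (by simp) h1
  · rw [CharP.cast_eq_zero_iff F p] at h1
    exact not_dvd_choose_three_mul he m k (by rw [← hq, hqm]) h1

/-- A prime `p ≡ 3 (mod 4)` to an even power is a sum of two squares only trivially. -/
lemma eq_zero_of_sq_add_sq_eq_prime_pow {p : ℕ} (hp : p.Prime) (h3 : p % 4 = 3) (s : ℕ)
    {a b : ℤ} (h : a ^ 2 + b ^ 2 = ((p : ℤ) ^ s) ^ 2) : a = 0 ∨ b = 0 := by
  induction s generalizing a b with
  | zero =>
    by_contra! hab
    have h1 := Int.one_le_abs hab.1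
    have h2 := Int.one_le_abs hab.2
    rw [pow_zero, one_pow, ← sq_abs a, ← sq_abs b] at h
    nlinarith
  | succ s ih =>
    have := Fact.mk hp
    have hpi : (p : ℤ) ≠ 0 := by exact_mod_cast hp.ne_zero
    have hz : ((a : ZMod p)) ^ 2 + (b : ZMod p) ^ 2 = 0 := by
      have := congrArg (Int.cast (R := ZMod p)) h
      push_cast at this
      rw [this]; simp
    -- Otherwise a/b would be a square root of -1 modulo p ≡ 3 (mod 4); so p divides both and the
    -- equation descends.
    have hb : (b : ZMod p) = 0 := by
      by_contra hb
      refine ZMod.exists_sq_eq_neg_one_iff.1 ⟨(a : ZMod p) / (b : ZMod p), ?_⟩ h3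
      field_simp
      linear_combination -hz
    have ha : (a : ZMod p) = 0 := by
      rw [hb] at hz
      simpa using hz
    obtain ⟨a', rfl⟩ := (ZMod.intCast_zmod_eq_zero_iff_dvd a p).1 ha
    obtain ⟨b', rfl⟩ := (ZMod.intCast_zmod_eq_zero_iff_dvd b p).1 hb
    have : a' ^ 2 + b' ^ 2 = ((p : ℤ) ^ s) ^ 2 := by
      refine mul_left_cancel₀ (pow_ne_zero 2 hpi) ?_
      rw [pow_succ] at h
      linear_combination h
    rcases ih this with h | h <;> simp [h]

/-- Put P = p^N. It divides (cd' - c'd)(cd' + c'd), and p cannot divide both factors, so P divides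
one of them. By P² = (cc' + 4dd')² + 4(cd' - c'd)² (or its version with -d') a nonzero multiple of P
would be too large, so that factor is 0. -/
lemma sq_eq_sq_of_primitive_rep {p : ℕ} (hp : p.Prime) (hp2 : p ≠ 2) {N : ℕ} {c d c' d' : ℤ}
    (hN : 0 < N)
    (h : (p : ℤ) ^ N = c ^ 2 + 4 * d ^ 2) (h' : (p : ℤ) ^ N = c' ^ 2 + 4 * d' ^ 2)
    (hc : IsCoprime c p) (hc' : IsCoprime c' p) : c ^ 2 = c' ^ 2 ∧ d ^ 2 = d' ^ 2 := by
  have hpp : Prime (p : ℤ) := Nat.prime_iff_prime_int.1 hp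
  have hp4 : IsCoprime (p : ℤ) 2 := by
    rw [Int.isCoprime_iff_gcd_eq_one]
    exact (Nat.coprime_primes hp Nat.prime_two).2 hp2
  have hd : ∀ {c d : ℤ}, (p : ℤ) ^ N = c ^ 2 + 4 * d ^ 2 → IsCoprime c p → ¬ (p : ℤ) ∣ d := by
    intro c d h hc hd
    have : (p : ℤ) ∣ c ^ 2 := by
      rw [show c ^ 2 = (p : ℤ) ^ N - d * (4 * d) by rw [h]; ring]
      exact dvd_sub (dvd_pow_self _ hN.ne') (hd.mul_right _)
    exact hpp.not_isUnit (hc.symm.isUnit_of_dvd (hpp.dvd_of_dvd_pow this))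
  have hprod : (p : ℤ) ^ N ∣ (c * d' - c' * d) * (c * d' + c' * d) :=
    ⟨d' ^ 2 - d ^ 2, by linear_combination (-d' ^ 2) * h + d ^ 2 * h'⟩
  have hP : (0 : ℤ) < (p : ℤ) ^ N := by have := hp.pos; positivity
  have key : ∀ d' : ℤ, (p : ℤ) ^ N = c' ^ 2 + 4 * d' ^ 2 → (p : ℤ) ^ N ∣ c * d' - c' * d →
      c ^ 2 = c' ^ 2 ∧ d ^ 2 = d' ^ 2 := by
    rintro d' h' ⟨w, hw⟩
    have hid : ((p : ℤ) ^ N) ^ 2 = (c * c' + 4 * d * d') ^ 2 + 4 * (c * d' - c' * d) ^ 2 := by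
      rw [sq]
      nth_rewrite 1 [h]
      rw [h']; ring
    have hw0 : w = 0 := by
      by_contra hw0
      have h1 : 1 ≤ w ^ 2 := by have := sq_pos_of_ne_zero hw0; omega
      rw [hw] at hid
      nlinarith [sq_nonneg (c * c' + 4 * d * d'), pow_pos hP 2]
    rw [hw0, mul_zero] at hw
    have hcd : (p : ℤ) ^ N * (d' ^ 2 - d ^ 2) = 0 := by
      have : (c * d' - c' * d) * (c * d' + c' * d) = 0 := by rw [hw, zero_mul]
      rw [← this]; linear_combination d' ^ 2 * h - d ^ 2 * h'
    have hdd := (mul_eq_zero.1 hcd).resolve_left hP.ne'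
    exact ⟨by linarith, by linarith⟩
  by_cases h1 : (p : ℤ) ∣ c * d' - c' * d
  · have h2 : ¬ (p : ℤ) ∣ c * d' + c' * d := by
      intro h2
      have : (p : ℤ) ∣ 2 * (c * d') := by
        have := dvd_add h1 h2
        rwa [show c * d' - c' * d + (c * d' + c' * d) = 2 * (c * d') by ring] at this
      exact hd h' hc' (hc.symm.dvd_of_dvd_mul_left (hp4.dvd_of_dvd_mul_left this))
    exact key d' h' ((((hpp.coprime_iff_not_dvd).2 h2).pow_left).dvd_of_dvd_mul_right hprod)
  · have h2 := (((hpp.coprime_iff_not_dvd).2 h1).pow_left (m := N)).dvd_of_dvd_mul_left hprod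
    have := key (-d') (by rw [neg_sq]; exact h') (by
      rw [show c * -d' - c' * d = -(c * d' + c' * d) by ring]; exact (dvd_neg).2 h2)
    rwa [neg_sq] at this

end NumberTheory

/-! ### Counting multiplicities -/

section Multiplicities

variable {F : Type*} [Field F] [Fintype F] [DecidableEq F]

/-- Multiplication by g permutes the four nonzero level sets of χ cyclically, so they have equal
size. -/
lemma card_filter_quarticChar {k : ℕ} (hq : Fintype.card F = 4 * k + 1) {g : F} (hg : g ≠ 0)
    {χ : MulChar F GaussianInt} (hχg : χ g = ⟨0, 1⟩) (hχ4 : χ ^ 4 = 1) :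
    #{b | χ b = 1} = k ∧ #{b | χ b = -1} = k ∧ #{b | χ b = ⟨0, 1⟩} = k ∧
      #{b | χ b = -⟨0, 1⟩} = k ∧
      (univ : Finset F).val = 0 ::ₘ (({b | χ b = 1} : Finset F).val +
        ({b | χ b = -1} : Finset F).val + ({b | χ b = ⟨0, 1⟩} : Finset F).val +
        ({b | χ b = -⟨0, 1⟩} : Finset F).val) := by
  have hstep : ∀ z w : GaussianInt, ⟨0, 1⟩ * z = w → #{b | χ b = w} = #{b | χ b = z} := by
    rintro z w rfl
    refine (card_bij (fun b _ => g * b) ?_ (fun _ _ _ _ => mul_left_cancel₀ hg) ?_).symm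
    · intro b hb
      rw [mem_filter] at hb ⊢
      simp [hχg, hb.2]
    · intro b hb
      rw [mem_filter] at hb
      refine ⟨g⁻¹ * b, ?_, mul_inv_cancel_left₀ hg b⟩
      rw [mem_filter, map_mul]
      refine ⟨mem_univ _, ?_⟩
      have : χ g⁻¹ * ⟨0, 1⟩ = 1 := by rw [← hχg, ← map_mul, inv_mul_cancel₀ hg, map_one]
      rw [hb.2, ← mul_assoc, this, one_mul]
  have h1 := hstep 1 ⟨0, 1⟩ (by decide)
  have h2 := hstep ⟨0, 1⟩ (-1) (by decide)
  have h3 := hstep (-1) (-⟨0, 1⟩) (by decide)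
  have hval : (univ : Finset F).val = 0 ::ₘ (({b | χ b = 1} : Finset F).val +
        ({b | χ b = -1} : Finset F).val + ({b | χ b = ⟨0, 1⟩} : Finset F).val +
        ({b | χ b = -⟨0, 1⟩} : Finset F).val) := by
    ext b
    rw [Multiset.count_cons]
    simp only [Multiset.count_add, Multiset.count_eq_of_nodup (Finset.nodup _), mem_val,
      mem_filter, mem_univ, true_and]
    by_cases hb : b = 0
    · subst hb
      have hne : (0 : GaussianInt) ≠ 1 ∧ (0 : GaussianInt) ≠ -1 ∧ (0 : GaussianInt) ≠ ⟨0, 1⟩ ∧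
        (0 : GaussianInt) ≠ -⟨0, 1⟩ := by decide
      simp only [MulChar.map_zero, hne, if_true, if_false]
    · have hx4 : χ b ^ 4 = 1 := by
        rw [← MulChar.pow_apply' _ four_ne_zero, hχ4, MulChar.one_apply (Ne.isUnit hb)]
      simp only [if_neg hb]
      rcases pow_four_eq_one_cases hx4 with h | h | h | h <;> rw [h] <;> decide
  have hcard := congrArg Multiset.card hval
  simp only [Multiset.card_cons, Multiset.card_add, card_val, card_univ, hq] at hcard
  exact ⟨by omega, by omega, by omega, by omega, hval⟩

/-- Negation preserves C and exchanges θ = 1 with θ = -1, so each sign is taken on half of C. -/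
lemma map_val_odd_sign {F : Type*} [Field F] [DecidableEq F] {C : Finset F} (hC : ∀ b ∈ C, -b ∈ C) (h0 : (0 : F) ∉ C) {h : ℕ}
    (hcard : #C = 2 * h) {θ : F → ℤ} (hneg : ∀ b, θ (-b) = -θ b)
    (hθ : ∀ b, b ≠ 0 → θ b = 1 ∨ θ b = -1) {E : F → ℂ} {e x : ℂ} (hE : ∀ b ∈ C, E b = e) :
    C.val.map (fun b => if b = 0 then x else θ b * E b) =
      Multiset.replicate h e + Multiset.replicate h (-e) := by
  have hne : ∀ b ∈ C, b ≠ 0 := fun b hb hb0 => h0 (hb0 ▸ hb)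
  have hp : #{b ∈ C | θ b = 1} = #{b ∈ C | ¬ θ b = 1} := by
    refine card_bij (fun b _ => -b) ?_ (fun _ _ _ _ => neg_injective.eq_iff.1) ?_
    · intro b hb
      rw [mem_filter] at hb ⊢
      refine ⟨hC _ hb.1, ?_⟩
      rw [hneg, hb.2]; decide
    · intro b hb
      rw [mem_filter] at hb
      refine ⟨-b, ?_, neg_neg b⟩
      rw [mem_filter, hneg, (hθ b (hne b hb.1)).resolve_left hb.2]
      exact ⟨hC _ hb.1, by decide⟩
  have htot := card_filter_add_card_filter_not (s := C) (fun b => θ b = 1)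
  rw [← Multiset.filter_add_not (fun b => θ b = 1) C.val, Multiset.map_add]
  congr 1
  · rw [Multiset.eq_replicate]
    refine ⟨?_, fun y hy => ?_⟩
    · rw [Multiset.card_map, ← filter_val, card_val]; omega
    · obtain ⟨b, hb, rfl⟩ := Multiset.mem_map.1 hy
      rw [Multiset.mem_filter] at hb
      rw [if_neg (hne b hb.1), hE b hb.1, hb.2]; simp
  · rw [Multiset.eq_replicate]
    refine ⟨?_, fun y hy => ?_⟩
    · rw [Multiset.card_map, ← filter_val, card_val]; omega
    · obtain ⟨b, hb, rfl⟩ := Multiset.mem_map.1 hy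
      rw [Multiset.mem_filter] at hb
      rw [if_neg (hne b hb.1), hE b hb.1, (hθ b (hne b hb.1)).resolve_left hb.2]; simp

lemma map_val_eq_replicate {F : Type*} {C : Finset F} {k : ℕ} (hcard : #C = k) {E : F → ℂ} {e : ℂ}
    (hE : ∀ b ∈ C, E b = e) : C.val.map E = Multiset.replicate k e := by
  rw [Multiset.eq_replicate]
  refine ⟨by rw [Multiset.card_map, card_val, hcard], fun y hy => ?_⟩
  obtain ⟨b, hb, rfl⟩ := Multiset.mem_map.1 hy
  exact hE b hb

end Multiplicities

/-! ### Connectedness of the sum graph -/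

section Connectedness

variable {F : Type*} [Field F]

/-- For x ∈ S the two steps v → -x - v → v + 2x translate by 2x; when S generates F and 2 is
invertible, these translations reach everything. -/
lemma connected_cayleySum_of_closure_eq_top {S : Set F} (hS : ∀ x, -x ∈ S ↔ x ∈ S)
    (h2 : (2 : F) ≠ 0) (htop : AddSubgroup.closure S = ⊤) : Connected (cayleySum S) := by
  have hadj : ∀ v w : F, v + w ∈ S → (cayleySum S).toSimpleGraphInclusive.Reachable v w :=
    fun v w h => by
      by_cases hvw : v = w
      · rw [hvw]
      · exact SimpleGraph.Adj.reachable ⟨hvw, Or.inl h⟩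
  have hreach : ∀ x ∈ AddSubgroup.closure S, ∀ v,
      (cayleySum S).toSimpleGraphInclusive.Reachable v (v + 2 * x) := by
    intro x hx
    induction hx using AddSubgroup.closure_induction with
    | mem x hx =>
      intro v
      refine (hadj v (-x - v) ?_).trans (hadj _ _ ?_)
      · rw [show v + (-x - v) = -x by ring]; exact (hS x).2 hx
      · rw [show -x - v + (v + 2 * x) = x by ring]; exact hx
    | zero => intro v; rw [mul_zero, add_zero]
    | add x y _ _ hx hy =>
      intro v
      rw [mul_add, ← add_assoc]
      exact (hx v).trans (hy _)
    | neg x _ hx =>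
      intro v
      have := (hx (v + 2 * -x)).symm
      rwa [show v + 2 * -x + 2 * x = v by ring] at this
  have : Nonempty F := ⟨0⟩
  refine SimpleGraph.Connected.mk fun v w => ?_
  have := hreach ((w - v) / 2) (by rw [htop]; trivial) v
  rwa [mul_div_cancel₀ _ h2, add_sub_cancel] at this

/-- If S generated a proper subgroup, a nontrivial character of the quotient would pull back to some
ψ_b, b ≠ 0, trivial on S, so that E(b) = |S|. -/
lemma closure_eq_top_of_expSum_ne [Fintype F] {S : Set F} {ψ : AddChar F ℂ} (hψ : ψ.IsPrimitive)
    (h : ∀ b, b ≠ 0 → expSum S ψ b ≠ S.ncard) : AddSubgroup.closure S = ⊤ := by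
  by_contra hne
  obtain ⟨x, -, hx⟩ := SetLike.exists_of_lt (lt_top_iff_ne_top.2 hne)
  have hx0 : (QuotientAddGroup.mk x : F ⧸ AddSubgroup.closure S) ≠ 0 := by
    rwa [Ne, QuotientAddGroup.eq_zero_iff]
  obtain ⟨ψ', hψ'⟩ := AddChar.exists_apply_ne_zero.2 hx0
  have hsurj : Function.Surjective (fun b => ψ.mulShift b) :=
    ((Fintype.bijective_iff_injective_and_card _).2
      ⟨AddChar.to_mulShift_inj_of_isPrimitive hψ, AddChar.card_eq.symm⟩).2
  obtain ⟨b, hb⟩ := hsurj (ψ'.compAddMonoidHom (QuotientAddGroup.mk' (AddSubgroup.closure S)))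
  have hb' : ∀ y, ψ (b * y) = ψ' (QuotientAddGroup.mk y) := fun y => by
    have := congrArg (fun f : AddChar F ℂ => f y) hb
    simpa [AddChar.mulShift_apply] using this
  refine h b ?_ ?_
  · rintro rfl
    rw [← hb', zero_mul, AddChar.map_zero_eq_one] at hψ'
    exact hψ' rfl
  · rw [← expSum_zero_right S ψ, expSum, expSum]
    refine sum_congr rfl fun y _ => ?_
    by_cases hy : y ∈ S
    · rw [Set.indicator_of_mem hy, Set.indicator_of_mem hy, hb', zero_mul,
        (QuotientAddGroup.eq_zero_iff y).2 (AddSubgroup.subset_closure hy),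
        AddChar.map_zero_eq_one, AddChar.map_zero_eq_one]
    · rw [Set.indicator_of_notMem hy, Set.indicator_of_notMem hy]

end Connectedness

/-! ### Both spectra in terms of the quartic Gauss sum -/

section Main

/-- The spectra of the quartic Paley graph and sum graph in terms of the real and imaginary parts
`A`, `B` of a quartic Gauss sum. -/
theorem exists_eigenvalues {F : Type*} [Field F] [Fintype F] {p m r h : ℕ} [hp : Fact p.Prime]
    [CharP F p] (hp2 : p ≠ 2) (hqm : Fintype.card F = p ^ m) (hqr : Fintype.card F = r ^ 2)
    (hqh : Fintype.card F = 4 * (2 * h) + 1) (hr : 3 < r) (hdiv : p - 1 ∣ 2 * h) :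
    ∃ A B e₁ e₂ e₃ e₄ : ℤ, A ^ 2 + B ^ 2 = (r : ℤ) ^ 2 ∧
      4 * e₁ = -1 + r + 2 * A ∧ 4 * e₂ = -1 + r - 2 * A ∧
      4 * e₃ = -1 - r + 2 * B ∧ 4 * e₄ = -1 - r - 2 * B ∧
      Connected (paleySum 4 F) ∧
      eigenvalues (paley 4 F) = ((2 * h : ℕ) : ℂ) ::ₘ
        (Multiset.replicate (2 * h) (e₁ : ℂ) + Multiset.replicate (2 * h) (e₂ : ℂ) +
          Multiset.replicate (2 * h) (e₃ : ℂ) + Multiset.replicate (2 * h) (e₄ : ℂ)) ∧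
      eigenvalues (paleySum 4 F) = ((2 * h : ℕ) : ℂ) ::ₘ
        ((Multiset.replicate h (e₁ : ℂ) + Multiset.replicate h (-e₁ : ℂ)) +
         (Multiset.replicate h (e₂ : ℂ) + Multiset.replicate h (-e₂ : ℂ)) +
         (Multiset.replicate h (e₃ : ℂ) + Multiset.replicate h (-e₃ : ℂ)) +
         (Multiset.replicate h (e₄ : ℂ) + Multiset.replicate h (-e₄ : ℂ))) ∧
      ∀ t, p % 4 = 1 → r = p ^ (2 * t) →
        ∃ A' B' : ℤ, A = p ^ t * A' ∧ B = p ^ t * B' ∧ ¬ ((p : ℤ) ∣ A' ∧ (p : ℤ) ∣ B') := by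
  classical
  have hh : 0 < 2 * h := by
    rcases Nat.eq_zero_or_pos h with rfl | h0
    · rw [hqr] at hqh
      nlinarith
    · omega
  obtain ⟨g, χ, f, hg, hχg, hχ, hχk, hf⟩ := exists_quarticChar hqh hh
  have hneg : χ (-1) = 1 := (hχk _ (neg_ne_zero.2 one_ne_zero)).2 (by rw [pow_mul]; simp)
  have hχ4 : χ ^ 4 = 1 := by
    refine MulChar.ext fun x => ?_
    rw [MulChar.pow_apply_coe, MulChar.one_apply_coe, ← map_pow, hχ _ (pow_ne_zero _ x.ne_zero)]
    exact ⟨x, x.ne_zero, rfl⟩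
  obtain ⟨ψ, hψ, hψr⟩ := exists_gaussSum_sq_eq hqr hg hχg hneg hχ4
  have hE := fun b hb => four_mul_expSum_eq (b := b) hχ hneg hχ4 hψ hψr hb
  have hnorm := norm_quarticGaussSum hg hχg hψ
  have hJ := quarticGaussSum_sq hg hχg hψr
  have hS : ∀ x : F, -x ∈ powers 4 F ↔ x ∈ powers 4 F := fun x => by
    rw [← neg_one_mul]
    exact mul_mem_powers_iff ((hχ _ (neg_ne_zero.2 one_ne_zero)).1 hneg)
  -- With k = 2h a multiple of p - 1, Fermat gives a^k = 1.
  have hprime : ∀ a : ℕ, (a : F) ≠ 0 → (a : F) ∈ powers 4 F := fun a ha => by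
    obtain ⟨l, hl⟩ := hdiv
    rw [← hχ _ ha, hχk _ ha, hl, pow_mul]
    have h1 : (a : F) ^ p = a := map_natCast (frobenius F p) a
    have h2 : (a : F) ^ (p - 1) = 1 := by
      refine mul_right_cancel₀ ha ?_
      rw [← pow_succ, Nat.sub_add_cancel hp.out.one_le, h1, one_mul]
    rw [h2, one_pow]
  have hint := exists_int_eq_expSum (n := 4) hprime ψ
  set G := quarticGaussSum χ ψ with hG
  have hodd : r % 2 = 1 := by
    by_contra hodd
    have : 2 ∣ r ^ 2 := (Nat.dvd_of_mod_eq_zero (by omega)).trans (dvd_pow_self r two_ne_zero)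
    rw [← hqr, hqh] at this
    omega
  obtain ⟨hc1, hc2, hc3, hc4, huniv⟩ := card_filter_quarticChar hqh hg hχg hχ4
  have h00 : χ 0 = 0 := MulChar.map_zero χ
  have hmem : ∀ z : GaussianInt, z ≠ 0 → ∀ b ∈ ({b | χ b = z} : Finset F), b ≠ 0 := by
    rintro z hz b hb rfl
    rw [mem_filter, h00] at hb
    exact hz hb.2.symm
  have hval : ∀ z : GaussianInt, z ≠ 0 → #{b | χ b = z} = 2 * h → ∃ e : ℤ,
      (∀ b ∈ ({b | χ b = z} : Finset F), expSum (powers 4 F) ψ b = e) ∧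
      4 * (e : ℂ) = -1 + (GaussianInt.toComplex z) ^ 2 * r +
        star (GaussianInt.toComplex z) * G + GaussianInt.toComplex z * star G := by
    intro z hz hcard
    obtain ⟨b, hb⟩ := card_pos.1 (hcard.symm ▸ hh)
    obtain ⟨e, he⟩ := hint b
    have hb2 := (mem_filter.1 hb).2
    refine ⟨e, fun b' hb' => ?_, ?_⟩
    · refine mul_left_cancel₀ (by norm_num : (4 : ℂ) ≠ 0) ?_
      rw [← he, hE b (hmem z hz b hb), hE b' (hmem z hz b' hb'), hb2, (mem_filter.1 hb').2]
    · rw [← he, hE b (hmem z hz b hb), hb2]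
  obtain ⟨e₁, he₁, hG₁⟩ := hval 1 (by decide) hc1
  obtain ⟨e₂, he₂, hG₂⟩ := hval (-1) (by decide) hc2
  obtain ⟨e₃, he₃, hG₃⟩ := hval ⟨0, 1⟩ (by decide) hc3
  obtain ⟨e₄, he₄, hG₄⟩ := hval (-⟨0, 1⟩) (by decide) hc4
  have hr₁ : 4 * (e₁ : ℝ) = -1 + r + 2 * G.re := by
    have := congrArg Complex.re hG₁
    simp at this; linarith
  have hr₂ : 4 * (e₂ : ℝ) = -1 + r - 2 * G.re := by
    have := congrArg Complex.re hG₂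
    simp at this; linarith
  have hr₃ : 4 * (e₃ : ℝ) = -1 - r + 2 * G.im := by
    have := congrArg Complex.re hG₃
    simp [GaussianInt.toComplex_def] at this; linarith
  have hr₄ : 4 * (e₄ : ℝ) = -1 - r - 2 * G.im := by
    have := congrArg Complex.re hG₄
    simp [GaussianInt.toComplex_def] at this; linarith
  -- Integrality of A and B follows from that of the periods, because r is odd.
  obtain ⟨A, hA⟩ : ∃ A : ℤ, (A : ℝ) = G.re := by
    refine ⟨2 * e₁ - (r - 1 : ℤ) / 2, ?_⟩
    have : ((2 * ((r - 1 : ℤ) / 2) : ℤ) : ℝ) = ((r - 1 : ℤ) : ℝ) := by congr 1; omega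
    push_cast at this ⊢
    linarith
  obtain ⟨B, hB⟩ : ∃ B : ℤ, (B : ℝ) = G.im := by
    refine ⟨2 * e₃ + (r + 1 : ℤ) / 2, ?_⟩
    have : ((2 * ((r + 1 : ℤ) / 2) : ℤ) : ℝ) = ((r + 1 : ℤ) : ℝ) := by congr 1; omega
    push_cast at this ⊢
    linarith
  have hGAB : G = GaussianInt.toComplex ⟨A, B⟩ := by
    apply Complex.ext <;> simp [hA, hB]
  rw [← hA] at hr₁ hr₂
  rw [← hB] at hr₃ hr₄
  have hAB : A ^ 2 + B ^ 2 = (r : ℤ) ^ 2 := by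
    have := congrArg Complex.re hnorm
    rw [hqr] at this
    simp [hGAB, ← Complex.ofReal_natCast, ← Complex.ofReal_pow] at this
    have h2 : ((A ^ 2 + B ^ 2 : ℤ) : ℝ) = ((r ^ 2 : ℤ) : ℝ) := by push_cast; linarith
    exact_mod_cast h2
  have hz₁ : 4 * e₁ = -1 + r + 2 * A := by exact_mod_cast hr₁
  have hz₂ : 4 * e₂ = -1 + r - 2 * A := by exact_mod_cast hr₂
  have hz₃ : 4 * e₃ = -1 - r + 2 * B := by exact_mod_cast hr₃
  have hz₄ : 4 * e₄ = -1 - r - 2 * B := by exact_mod_cast hr₄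
  have hncard : (powers 4 F).ncard = 2 * h := by
    rw [← hc1, Set.ncard_eq_toFinset_card']
    congr 1
    ext x
    rw [Set.mem_toFinset, mem_filter]
    by_cases hx : x = 0
    · subst hx
      rw [h00]
      refine ⟨fun ⟨y, hy, hy4⟩ => absurd hy4 (pow_ne_zero _ hy), fun h => ?_⟩
      exact absurd h.2 (by decide)
    · rw [hχ x hx]; simp
  refine ⟨A, B, e₁, e₂, e₃, e₄, hAB, hz₁, hz₂, hz₃, hz₄, ?_, ?_, ?_, ?_⟩
  · have h2F : (2 : F) ≠ 0 := by
      intro h2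
      have h2' : ((2 : ℕ) : F) = 0 := by exact_mod_cast h2
      rw [CharP.cast_eq_zero_iff F p, Nat.prime_dvd_prime_iff_eq hp.out Nat.prime_two] at h2'
      exact hp2 h2'
    refine connected_cayleySum_of_closure_eq_top hS h2F (closure_eq_top_of_expSum_ne hψ ?_)
    intro b hb
    rw [hncard]
    have hAr : |A| ≤ r := abs_le_of_sq_le_sq (by nlinarith) (by positivity)
    have hBr : |B| ≤ r := abs_le_of_sq_le_sq (by nlinarith) (by positivity)
    rw [abs_le] at hAr hBr
    have hbig : 4 * (2 * (h : ℤ)) + 1 = r ^ 2 := by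
      rw [hqr] at hqh
      exact_mod_cast hqh.symm
    have hr' : (3 : ℤ) < r := by exact_mod_cast hr
    -- As |A|, |B| ≤ r, every period is at most (3r - 1)/4, below (r² - 1)/4 = 2h exactly because r
    -- > 3.
    have hlt : ∀ e : ℤ, 4 * e ≤ -1 + 3 * r → (e : ℂ) ≠ ((2 * h : ℕ) : ℂ) := fun e he heq => by
      have : e = 2 * h := by exact_mod_cast heq
      nlinarith
    have hx4 : χ b ^ 4 = 1 := by
      rw [← MulChar.pow_apply' _ four_ne_zero, hχ4, MulChar.one_apply (Ne.isUnit hb)]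
    rcases pow_four_eq_one_cases hx4 with hb | hb | hb | hb
    · rw [he₁ b (by simp [hb])]; exact hlt _ (by linarith)
    · rw [he₂ b (by simp [hb])]; exact hlt _ (by linarith)
    · rw [he₃ b (by simp [hb])]; exact hlt _ (by linarith)
    · rw [he₄ b (by simp [hb])]; exact hlt _ (by linarith)
  · rw [paley, eigenvalues_cayley _ hψ, huniv, Multiset.map_cons, Multiset.map_add,
      Multiset.map_add, Multiset.map_add, map_val_eq_replicate hc1 he₁,
      map_val_eq_replicate hc2 he₂, map_val_eq_replicate hc3 he₃, map_val_eq_replicate hc4 he₄,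
      expSum_zero_right, hncard]
  · have hF2 : ringChar F ≠ 2 := by rwa [ringChar.eq F p]
    obtain ⟨θ, hθ0, hθneg, hθ⟩ := exists_odd_sign hF2
    have hCneg : ∀ z : GaussianInt, ∀ b ∈ ({b | χ b = z} : Finset F),
        -b ∈ ({b | χ b = z} : Finset F) := fun z b hb => by
      rw [mem_filter] at hb ⊢
      rw [← neg_one_mul, map_mul, hneg, one_mul]
      exact ⟨mem_univ _, hb.2⟩
    have hC0 : ∀ z : GaussianInt, z ≠ 0 → (0 : F) ∉ ({b | χ b = z} : Finset F) :=
      fun z hz h0 => hmem z hz 0 h0 rfl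
    rw [paleySum, eigenvalues_cayleySum hS hψ hθ0 hθneg hθ, huniv, Multiset.map_cons,
      Multiset.map_add, Multiset.map_add, Multiset.map_add, if_pos rfl,
      map_val_odd_sign (hCneg _) (hC0 _ (by decide)) hc1 hθneg hθ he₁,
      map_val_odd_sign (hCneg _) (hC0 _ (by decide)) hc2 hθneg hθ he₂,
      map_val_odd_sign (hCneg _) (hC0 _ (by decide)) hc3 hθneg hθ he₃,
      map_val_odd_sign (hCneg _) (hC0 _ (by decide)) hc4 hθneg hθ he₄,
      expSum_zero_right, hncard]
  · intro t hp1 hrt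
    -- G² = r·J(χ,χ) with r = (p^t)², so p^t divides G in the integrally closed ring ℤ[i]; the
    -- quotient z has z² = J(χ,χ), whence p ∤ z.
    have hJ' : (⟨A, B⟩ : GaussianInt) ^ 2 = ((p : GaussianInt) ^ t) ^ 2 * jacobiSum χ χ := by
      apply GaussianInt.toComplex_injective
      rw [map_pow, ← hGAB, hJ, hrt, map_mul]
      rw [map_pow, map_pow, map_natCast, ← pow_mul, mul_comm t 2, Nat.cast_pow]
    obtain ⟨z, hz⟩ := (IsIntegrallyClosed.pow_dvd_pow_iff two_ne_zero).1 (Dvd.intro _ hJ'.symm)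
    have hp0 : (p : GaussianInt) ≠ 0 := by exact_mod_cast hp.out.ne_zero
    have hzJ : z ^ 2 = jacobiSum χ χ := by
      refine mul_left_cancel₀ (pow_ne_zero 2 (pow_ne_zero t hp0)) ?_
      rw [← hJ', hz, mul_pow]
    have hpt : ((p : GaussianInt) ^ t) = (((p : ℤ) ^ t : ℤ) : GaussianInt) := by push_cast; rfl
    rw [hpt] at hz
    generalize hu : (p : ℤ) ^ t = u at hz
    refine ⟨z.re, z.im, ?_, ?_, ?_⟩
    · simpa using congrArg Zsqrtd.re hz
    · simpa using congrArg Zsqrtd.im hz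
    · intro hdvd
      refine not_dvd_jacobiSum (show p = 4 * (p / 4) + 1 by omega) hqh hqm hh hf ?_
      rw [← hzJ]
      have : ((p : ℤ) : GaussianInt) ∣ z := (Zsqrtd.intCast_dvd _ _).2 hdvd
      exact dvd_pow (by exact_mod_cast this) two_ne_zero

end Main

/-! ### Arithmetic of q and distinctness of the eigenvalues -/

section Spectra

/-- Divisibility consequences of `4 ∣ (q - 1) / (p - 1)`. -/
lemma arith_of_four_dvd {p m : ℕ} (hp : p.Prime) (hp2 : p ≠ 2)
    (h4 : 4 ∣ (p ^ m - 1) / (p - 1)) :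
    Even m ∧ (p % 4 = 1 → 4 ∣ m) ∧ ∃ h, p ^ m = 4 * (2 * h) + 1 ∧ p - 1 ∣ 2 * h := by
  have hp1 := hp.two_le
  have hodd : p % 2 = 1 := hp.eq_two_or_odd.resolve_left hp2
  rw [← Nat.geomSum_eq hp1] at h4
  have hs : (p - 1) * ∑ i ∈ range m, p ^ i = p ^ m - 1 := by
    have := Nat.geomSum_eq hp1 m
    rw [this, Nat.mul_div_cancel' (Nat.sub_one_dvd_pow_sub_one p m)]
  -- If p ≡ 1 (mod N), then 1 + p + ⋯ + p^(m-1) ≡ m (mod N); this is used for N = 2 and N = 4.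
  have hmod : ∀ N : ℕ, p ≡ 1 [MOD N] → N ∣ 4 → N ∣ m := fun N hN hN4 => by
    have h0 : ∑ i ∈ range m, p ^ i ≡ m [MOD N] := by
      have : ∑ i ∈ range m, p ^ i ≡ ∑ i ∈ range m, 1 [MOD N] :=
        Nat.ModEq.sum fun i _ => by simpa using hN.pow i
      simpa using this
    exact (h0.dvd_iff dvd_rfl).1 (hN4.trans h4)
  refine ⟨even_iff_two_dvd.2 (hmod 2 hodd (by norm_num)), fun h => hmod 4 h dvd_rfl, ?_⟩
  obtain ⟨l, hl⟩ := h4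
  refine ⟨(p - 1) / 2 * l, ?_, ?_⟩
  · have h1 : p - 1 = 2 * ((p - 1) / 2) := by omega
    have h2 : 1 ≤ p ^ m := Nat.one_le_pow _ _ hp.pos
    have h3 : p ^ m = (p - 1) * (4 * l) + 1 := by rw [← hl, hs]; omega
    rw [h3, h1]
    simp only [Nat.mul_div_cancel_left _ two_pos]
    ring
  · rw [← mul_assoc, show 2 * ((p - 1) / 2) = p - 1 by omega]
    exact dvd_mul_right _ _

lemma hasSpec_of_two_values {V : Type*} [Fintype V] {Γ : Digraph V} {h : ℕ} (hh : 0 < h)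
    {n x y : ℝ} (hx : 0 < x) (hxy : x < y) (hyn : y < n)
    (hΓ : eigenvalues Γ = (n : ℂ) ::ₘ
      ((Multiset.replicate h (x : ℂ) + Multiset.replicate h (-x : ℂ)) +
       (Multiset.replicate h (x : ℂ) + Multiset.replicate h (-x : ℂ)) +
       (Multiset.replicate h (x : ℂ) + Multiset.replicate h (-x : ℂ)) +
       (Multiset.replicate h (y : ℂ) + Multiset.replicate h (-y : ℂ)))) :
    HasSpec Γ ((n, 1) :: (pm x (3 * h) ++ pm y h)) := by
  refine ⟨?_, ?_, ?_⟩
  · simp only [pm, List.map_cons, List.map_nil, List.cons_append, List.nil_append,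
      List.nodup_cons, List.mem_cons, List.not_mem_nil, not_or, or_false, List.nodup_nil,
      not_false_iff, and_true]
    refine ⟨⟨?_, ?_, ?_, ?_⟩, ⟨?_, ?_, ?_⟩, ⟨?_, ?_⟩, ?_⟩ <;> intro h <;> linarith
  · simp [pm, hh]
  · rw [hΓ, show 3 * h = h + h + h by ring]
    simp [pm, ← Multiset.singleton_add, Multiset.replicate_add]
    abel

lemma hasSpec_of_four_values {V : Type*} [Fintype V] {Γ : Digraph V} {h : ℕ} (hh : 0 < h)
    {u c d : ℤ} (hu : 3 < u) (hcd : c ^ 2 + 4 * d ^ 2 = u ^ 2) (hc : c ≠ 0) (hd : d ≠ 0)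
    {n e₁ e₂ e₃ e₄ : ℝ} (hn : n = (u * u ^ 3 - 1) / 4)
    (he₁ : e₁ = (u * (u + 4 * d) - 1) / 4) (he₂ : e₂ = (u * (u - 4 * d) - 1) / 4)
    (he₃ : e₃ = (u * (-u + 2 * c) - 1) / 4) (he₄ : e₄ = (u * (-u - 2 * c) - 1) / 4)
    (hΓ : eigenvalues Γ = (n : ℂ) ::ₘ
      ((Multiset.replicate h (e₁ : ℂ) + Multiset.replicate h (-e₁ : ℂ)) +
       (Multiset.replicate h (e₂ : ℂ) + Multiset.replicate h (-e₂ : ℂ)) +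
       (Multiset.replicate h (e₃ : ℂ) + Multiset.replicate h (-e₃ : ℂ)) +
       (Multiset.replicate h (e₄ : ℂ) + Multiset.replicate h (-e₄ : ℂ)))) :
    HasSpec Γ ((n, 1) :: (pm e₁ h ++ pm e₂ h ++ pm e₃ h ++ pm e₄ h)) := by
  refine ⟨?_, ?_, ?_⟩
  -- Every value listed, n included, is ± f(X) with X an integer. f(X) = -f(Y) would force u ∣ 2, so
  -- only the integers X need comparing.
  · let f : ℤ → ℝ := fun X => (u * X - 1) / 4
    have hinj : ∀ X Y, f X = f Y ↔ X = Y := fun X Y => by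
      refine ⟨fun h => ?_, fun h => h ▸ rfl⟩
      have h1 : (u : ℝ) * X = u * Y := by simp only [f] at h; linarith
      have h2 : u * X = u * Y := by exact_mod_cast h1
      exact mul_left_cancel₀ (by omega) h2
    have hne : ∀ X Y, ¬ f X = -f Y := fun X Y h => by
      have h1 : (u : ℝ) * (X + Y) = 2 := by simp only [f] at h; linarith
      have h2 : u * (X + Y) = 2 := by exact_mod_cast h1
      have := Int.le_of_dvd two_pos ⟨_, h2.symm⟩
      omega
    have hne' : ∀ X Y, ¬ -f X = f Y := fun X Y h => hne Y X h.symm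
    have hn' : n = f (u ^ 3) := by rw [hn]; simp [f]
    have h1 : e₁ = f (u + 4 * d) := by rw [he₁]; simp [f]
    have h2 : e₂ = f (u - 4 * d) := by rw [he₂]; simp [f]
    have h3 : e₃ = f (-u + 2 * c) := by rw [he₃]; simp [f]
    have h4 : e₄ = f (-u - 2 * c) := by rw [he₄]; simp [f]
    have hcu : |c| ≤ u := abs_le_of_sq_le_sq (by nlinarith [sq_nonneg d]) (by omega)
    have hdu : |2 * d| ≤ u := abs_le_of_sq_le_sq (by nlinarith [sq_nonneg c]) (by omega)
    rw [abs_le] at hcu hdu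
    have hu3 : 9 * u < u ^ 3 := by nlinarith [mul_pos (by omega : 0 < u) (by omega : 0 < u)]
    -- A collision means u = c - 2d, and then c² + 4d² = u² gives cd = 0; sign changes cover the
    -- other three cases.
    have hmix : ∀ c d : ℤ, c ≠ 0 → d ≠ 0 → c ^ 2 + 4 * d ^ 2 = u ^ 2 →
        u + 4 * d ≠ -u + 2 * c := fun c d hc hd hcd h => by
      have hu : u = c - 2 * d := by linarith
      rw [hu] at hcd
      have : c * d = 0 := by linarith
      rcases mul_eq_zero.1 this with h | h <;> contradiction
    have m1 := hmix c d hc hd hcd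
    have m2 := hmix c (-d) hc (neg_ne_zero.2 hd) (by rwa [neg_sq])
    have m3 := hmix (-c) d (neg_ne_zero.2 hc) hd (by rwa [neg_sq])
    have m4 := hmix (-c) (-d) (neg_ne_zero.2 hc) (neg_ne_zero.2 hd) (by rwa [neg_sq, neg_sq])
    rw [hn', h1, h2, h3, h4]
    simp only [pm, List.map_cons, List.map_nil, List.cons_append, List.nil_append,
      List.nodup_cons, List.mem_cons, List.not_mem_nil, not_or, or_false, List.nodup_nil,
      not_false_iff, and_true, hinj, hne, hne', neg_inj, true_and]
    omega
  · simp [pm, hh]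
  · rw [hΓ]
    simp [pm, ← Multiset.singleton_add]
    abel

/-- The spectrum when the quartic Gauss sum is real or purely imaginary and `√q ≡ 1 (mod 4)`. -/
lemma hasSpec_of_two_periods {V : Type*} [Fintype V] {Γ : Digraph V} {h n r : ℕ}
    (hh : 0 < h) (hr : 3 < r) (hn : (n : ℝ) = ((r : ℝ) ^ 2 - 1) / 4) {a b : ℤ}
    (ha : 4 * a = -1 + r) (hb : 4 * b = -1 - 3 * r)
    (hΓ : eigenvalues Γ = (n : ℂ) ::ₘ
      ((Multiset.replicate h (a : ℂ) + Multiset.replicate h (-a : ℂ)) +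
       (Multiset.replicate h (a : ℂ) + Multiset.replicate h (-a : ℂ)) +
       (Multiset.replicate h (a : ℂ) + Multiset.replicate h (-a : ℂ)) +
       (Multiset.replicate h (b : ℂ) + Multiset.replicate h (-b : ℂ)))) :
    HasSpec Γ (((n : ℝ), 1) :: (pm (((r : ℝ) - 1) / 4) (3 * h) ++
      pm ((3 * (r : ℝ) + 1) / 4) h)) := by
  have hr4 : (4 : ℝ) ≤ r := by exact_mod_cast hr
  have ha' : ((r : ℝ) - 1) / 4 = a := by
    have : (4 : ℝ) * a = -1 + r := by exact_mod_cast ha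
    linarith
  have hb' : (3 * (r : ℝ) + 1) / 4 = -b := by
    have : (4 : ℝ) * b = -1 - 3 * r := by exact_mod_cast hb
    linarith
  refine hasSpec_of_two_values hh (by linarith) (by linarith) (by rw [hn]; nlinarith) ?_
  rw [hΓ, ha', hb']
  push_cast
  rw [neg_neg, add_comm (Multiset.replicate h (b : ℂ))]

/-- The spectrum when the quartic Gauss sum is real or purely imaginary and `√q ≡ 3 (mod 4)`. -/
lemma hasSpec_of_two_periods' {V : Type*} [Fintype V] {Γ : Digraph V} {h n r : ℕ}
    (hh : 0 < h) (hr : 3 < r) (hn : (n : ℝ) = ((r : ℝ) ^ 2 - 1) / 4) {a b : ℤ}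
    (ha : 4 * a = -1 - r) (hb : 4 * b = -1 + 3 * r)
    (hΓ : eigenvalues Γ = (n : ℂ) ::ₘ
      ((Multiset.replicate h (a : ℂ) + Multiset.replicate h (-a : ℂ)) +
       (Multiset.replicate h (a : ℂ) + Multiset.replicate h (-a : ℂ)) +
       (Multiset.replicate h (a : ℂ) + Multiset.replicate h (-a : ℂ)) +
       (Multiset.replicate h (b : ℂ) + Multiset.replicate h (-b : ℂ)))) :
    HasSpec Γ (((n : ℝ), 1) :: (pm (((r : ℝ) + 1) / 4) (3 * h) ++
      pm ((3 * (r : ℝ) - 1) / 4) h)) := by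
  have hr4 : (4 : ℝ) ≤ r := by exact_mod_cast hr
  have ha' : ((r : ℝ) + 1) / 4 = -a := by
    have : (4 : ℝ) * a = -1 - r := by exact_mod_cast ha
    linarith
  have hb' : (3 * (r : ℝ) - 1) / 4 = b := by
    have : (4 : ℝ) * b = -1 + 3 * r := by exact_mod_cast hb
    linarith
  refine hasSpec_of_two_values hh (by linarith) (by linarith) (by rw [hn]; nlinarith) ?_
  rw [hΓ, ha', hb']
  push_cast
  rw [neg_neg, add_comm (Multiset.replicate h (-a : ℂ))]

lemma two_nsmul_erase_eq {h : ℕ} {n e₁ e₂ e₃ e₄ : ℂ} {M N : Multiset ℂ}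
    (hN : N = n ::ₘ
        (Multiset.replicate (2 * h) e₁ + Multiset.replicate (2 * h) e₂ +
          Multiset.replicate (2 * h) e₃ + Multiset.replicate (2 * h) e₄))
    (hM : M = n ::ₘ
        ((Multiset.replicate h e₁ + Multiset.replicate h (-e₁)) +
         (Multiset.replicate h e₂ + Multiset.replicate h (-e₂)) +
         (Multiset.replicate h e₃ + Multiset.replicate h (-e₃)) +
         (Multiset.replicate h e₄ + Multiset.replicate h (-e₄)))) :
    2 • M.erase n = N.erase n + (N.erase n).map fun μ => -μ := by
  rw [hM, hN, Multiset.erase_cons_head, Multiset.erase_cons_head]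
  simp only [Multiset.map_add, Multiset.map_replicate, two_mul, Multiset.replicate_add, two_smul]
  abel

end Spectra

end GPGraph

/-! ### Assembly of the two cases -/

theorem theorem2p6 (p m q n : ℕ) (hp : p.Prime) (hp2 : p ≠ 2) (hq : q = p ^ m)
    (h4 : 4 ∣ (q - 1) / (p - 1)) (hq5 : 5 ≤ q) (hq9 : q ≠ 9) (hn : n = (q - 1) / 4)
    (F : Type*) [Field F] [Fintype F] (hF : Fintype.card F = q) :
    -- connected, with integral spectrum; `n` is even, so that all multiplicities below are exact
    GPGraph.Connected (GPGraph.paleySum 4 F) ∧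
    GPGraph.HasIntegralSpectrum (GPGraph.paleySum 4 F) ∧
    Even n ∧
    -- the non-principal eigenvalues are `±` those of `Γ(4, q)`, with halved multiplicities
    2 • (GPGraph.eigenvalues (GPGraph.paleySum 4 F)).erase (n : ℂ) =
      (GPGraph.eigenvalues (GPGraph.paley 4 F)).erase (n : ℂ) +
        ((GPGraph.eigenvalues (GPGraph.paley 4 F)).erase (n : ℂ)).map (fun μ => -μ) ∧
    -- the case `p ≡ 1 (mod 4)`
    (p ≡ 1 [MOD 4] →
      (∃ t : ℕ, m = 4 * t) ∧
      (∃ c d : ℤ, GPGraph.QuarticRep p q c d) ∧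
      (∀ c d c' d' : ℤ, GPGraph.QuarticRep p q c d → GPGraph.QuarticRep p q c' d' →
        c = c' ∧ |d| = |d'|) ∧
      (∀ c d : ℤ, GPGraph.QuarticRep p q c d →
        GPGraph.HasSpec (GPGraph.paleySum 4 F)
          (((n : ℝ), 1) ::
            (GPGraph.pm ((√(q : ℝ) + 4 * d * (q : ℝ) ^ (1 / 4 : ℝ) - 1) / 4) (n / 2) ++
             GPGraph.pm ((√(q : ℝ) - 4 * d * (q : ℝ) ^ (1 / 4 : ℝ) - 1) / 4) (n / 2) ++
             GPGraph.pm ((-√(q : ℝ) + 2 * c * (q : ℝ) ^ (1 / 4 : ℝ) - 1) / 4) (n / 2) ++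
             GPGraph.pm ((-√(q : ℝ) - 2 * c * (q : ℝ) ^ (1 / 4 : ℝ) - 1) / 4) (n / 2))))) ∧
    -- the case `p ≡ 3 (mod 4)`
    (p ≡ 3 [MOD 4] →
      (∃ t : ℕ, m = 2 * t) ∧
      (m ≡ 0 [MOD 4] →
        GPGraph.HasSpec (GPGraph.paleySum 4 F)
          (((n : ℝ), 1) ::
            (GPGraph.pm ((√(q : ℝ) - 1) / 4) (3 * n / 2) ++
             GPGraph.pm ((3 * √(q : ℝ) + 1) / 4) (n / 2)))) ∧
      (m ≡ 2 [MOD 4] →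
        GPGraph.HasSpec (GPGraph.paleySum 4 F)
          (((n : ℝ), 1) ::
            (GPGraph.pm ((√(q : ℝ) + 1) / 4) (3 * n / 2) ++
             GPGraph.pm ((3 * √(q : ℝ) - 1) / 4) (n / 2))))) := by
  have hpf : Fact p.Prime := ⟨hp⟩
  subst hq
  obtain ⟨heven, hm4, h, hqh, hdiv⟩ := GPGraph.arith_of_four_dvd hp hp2 h4
  obtain ⟨s, hs⟩ := heven
  have hs2 : m = s * 2 := by omega
  obtain ⟨r, hr⟩ : ∃ r, r = p ^ s := ⟨_, rfl⟩
  have hqr : p ^ m = r ^ 2 := by rw [hr, hs2, pow_mul]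
  have hr3 : 3 < r := by
    rw [hqr] at hq5 hq9
    by_contra hle
    have : r ≤ 3 := by omega
    interval_cases r <;> omega
  have hchar : CharP F p := by
    refine charP_of_card_eq_prime_pow (f := m) ?_
    rw [hF]
  have hn2 : n = 2 * h := by omega
  have hh : 0 < h := by omega
  have hn1 : n / 2 = h := by omega
  have hn3 : 3 * n / 2 = 3 * h := by omega
  have hsqrt : √((p ^ m : ℕ) : ℝ) = r := by
    rw [hqr, Nat.cast_pow, Real.sqrt_sq (Nat.cast_nonneg r)]
  have hnr : (n : ℝ) = ((r : ℝ) ^ 2 - 1) / 4 := by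
    have : (r : ℝ) ^ 2 = 4 * (2 * h) + 1 := by exact_mod_cast hqr.symm.trans hqh
    rw [this, hn2]; push_cast; ring
  have hrR : (3 : ℝ) < r := by exact_mod_cast hr3
  obtain ⟨A, B, e₁, e₂, e₃, e₄, hAB, h1, h2, h3, h5, hconn, hpal, hsum, hdvd⟩ :=
    GPGraph.exists_eigenvalues hp2 hF (hF.trans hqr) (hF.trans hqh) hr3 hdiv
  rw [← hn2] at hsum
  rw [hn1, hn3, hsqrt]
  refine ⟨hconn, ?_, ⟨h, by omega⟩, ?_, fun hp1 => ?_, fun hp3 => ?_⟩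
  · intro μ hμ
    rw [hsum] at hμ
    simp only [Multiset.mem_cons, Multiset.mem_add, Multiset.mem_replicate] at hμ
    rcases hμ with rfl | (((⟨-, rfl⟩ | ⟨-, rfl⟩) | (⟨-, rfl⟩ | ⟨-, rfl⟩)) |
      (⟨-, rfl⟩ | ⟨-, rfl⟩)) | (⟨-, rfl⟩ | ⟨-, rfl⟩)
    · exact ⟨n, by simp⟩
    · exact ⟨e₁, rfl⟩
    · exact ⟨-e₁, by simp⟩
    · exact ⟨e₂, rfl⟩
    · exact ⟨-e₂, by simp⟩
    · exact ⟨e₃, rfl⟩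
    · exact ⟨-e₃, by simp⟩
    · exact ⟨e₄, rfl⟩
    · exact ⟨-e₄, by simp⟩
  · exact GPGraph.two_nsmul_erase_eq (by rw [hpal, hn2]) hsum
  · replace hp1 : p % 4 = 1 := hp1
    obtain ⟨t, ht⟩ := hm4 hp1
    have ht0 : 0 < t := by
      rcases Nat.eq_zero_or_pos t with rfl | h0
      · rw [ht] at hq5; norm_num at hq5
      · exact h0
    have hrt : r = p ^ (2 * t) := by rw [hr]; congr 1; omega
    obtain ⟨A', B', hA', hB', hnd⟩ := hdvd t hp1 hrt
    obtain ⟨u, hu⟩ : ∃ u : ℤ, u = (p : ℤ) ^ t := ⟨_, rfl⟩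
    rw [← hu] at hA' hB'
    have hru : (r : ℤ) = u ^ 2 := by rw [hrt, hu]; push_cast; rw [← pow_mul, mul_comm]
    have hu0 : 0 < u := by rw [hu]; exact pow_pos (by exact_mod_cast hp.pos) t
    have hpu : (p : ℤ) ∣ u := hu ▸ dvd_pow_self _ ht0.ne'
    have hu3 : 3 < u := by
      have h5 : (5 : ℤ) ≤ p := by have := hp.two_le; omega
      exact lt_of_lt_of_le (by omega) (Int.le_of_dvd hu0 hpu)
    have hu4 : u % 4 = 1 := by
      have : u ≡ 1 [ZMOD 4] := by
        rw [hu]; simpa using (show (p : ℤ) ≡ 1 [ZMOD 4] by rw [Int.ModEq]; omega).pow t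
      simpa [Int.ModEq] using this
    obtain ⟨w, hw⟩ : ∃ w, u = 4 * w + 1 := ⟨u / 4, by omega⟩
    have hr8 : (r : ℤ) = 8 * (2 * (w * w) + w) + 1 := by rw [hru, hw]; ring
    -- With r ≡ 1 (mod 4), integrality of e₁ and e₃ forces A even and B odd. Hence A' = 2d₀, and c,
    -- d will be B', d₀ up to sign.
    have hAe : Even (u * A') := by rw [← hA', Int.even_iff]; omega
    have hBo : Odd (u * B') := by rw [← hB', Int.odd_iff]; omega
    have huo : ¬ Even u := by rw [Int.even_iff]; omega
    obtain ⟨d₀, hd₀⟩ := even_iff_two_dvd.1 ((Int.even_mul.1 hAe).resolve_left huo)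
    have hB'o : B' % 2 = 1 := Int.odd_iff.1 (Int.odd_mul.1 hBo).2
    have hnormu : B' ^ 2 + 4 * d₀ ^ 2 = u ^ 2 := by
      refine mul_left_cancel₀ (pow_ne_zero 2 hu0.ne') ?_
      rw [hru, hA', hB', hd₀] at hAB
      linear_combination hAB
    have hpB : IsCoprime B' (p : ℤ) := by
      have hpp := Nat.prime_iff_prime_int.1 hp
      refine ((hpp.coprime_iff_not_dvd).2 fun hdvdB => hnd ⟨?_, hdvdB⟩).symm
      refine hpp.dvd_of_dvd_pow (n := 2) ?_
      rw [show A' ^ 2 = u * u - B' * B' by rw [hd₀]; linear_combination hnormu]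
      exact dvd_sub (hpu.mul_right _) (hdvdB.mul_right _)
    have hrep : ∀ c d : ℤ, √((p ^ m : ℕ) : ℝ) = (c : ℝ) ^ 2 + 4 * (d : ℝ) ^ 2 ↔
        (p : ℤ) ^ (2 * t) = c ^ 2 + 4 * d ^ 2 := fun c d => by
      rw [hsqrt, hrt]
      exact_mod_cast Iff.rfl
    have hnorm' : (p : ℤ) ^ (2 * t) = B' ^ 2 + 4 * d₀ ^ 2 := by
      rw [hnormu, hu, ← pow_mul, mul_comm]
    have huniq : ∀ c d c' d' : ℤ, GPGraph.QuarticRep p (p ^ m) c d →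
        GPGraph.QuarticRep p (p ^ m) c' d' → c ^ 2 = c' ^ 2 ∧ d ^ 2 = d' ^ 2 :=
      fun c d c' d' h h' => GPGraph.sq_eq_sq_of_primitive_rep hp hp2 (by omega)
        ((hrep c d).1 h.1) ((hrep c' d').1 h'.1) h.2.2 h'.2.2
    refine ⟨⟨t, ht⟩, ?_, fun c d c' d' h h' => ?_, fun c d h => ?_⟩
    · by_cases hB4 : B' % 4 = 1
      · exact ⟨B', d₀, (hrep _ _).2 hnorm', hB4, hpB⟩
      · refine ⟨-B', d₀, (hrep _ _).2 (by rw [neg_sq]; exact hnorm'), ?_, hpB.neg_left⟩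
        rw [Int.ModEq]; omega
    · obtain ⟨hc, hd⟩ := huniq c d c' d' h h'
      refine ⟨(sq_eq_sq_iff_eq_or_eq_neg.1 hc).resolve_right fun hcc => ?_,
        (sq_eq_sq_iff_abs_eq_abs _ _).1 hd⟩
      have k1 := h.2.1
      have k2 := h'.2.1
      rw [Int.ModEq] at k1 k2
      omega
    · have hpu4 : ((p ^ m : ℕ) : ℝ) ^ (1 / 4 : ℝ) = u := by
        have : ((p ^ m : ℕ) : ℝ) = ((u : ℝ)) ^ (4 : ℝ) := by
          rw [hqr, Nat.cast_pow, show (r : ℝ) = (u : ℝ) ^ 2 by exact_mod_cast hru, ← pow_mul]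
          norm_cast
        rw [this, ← Real.rpow_mul (by exact_mod_cast hu0.le)]
        norm_num
      have hrep' := (hrep c d).1 h.1
      obtain ⟨hcB, hdd⟩ := GPGraph.sq_eq_sq_of_primitive_rep hp hp2 (by omega) hrep' hnorm'
        h.2.2 hpB
      have hcd : c ^ 2 + 4 * d ^ 2 = u ^ 2 := by rw [hcB, hdd, hnormu]
      have hc0 : c ≠ 0 := by
        rintro rfl
        have := h.2.1
        rw [Int.ModEq] at this
        omega
      have hd0 : d ≠ 0 := by
        rintro rfl
        refine (Nat.prime_iff_prime_int.1 hp).not_isUnit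
          (h.2.2.symm.isUnit_of_dvd ((Nat.prime_iff_prime_int.1 hp).dvd_of_dvd_pow (n := 2) ?_))
        rw [show c ^ 2 = u * u by linear_combination hcd]
        exact hpu.mul_right _
      have hrR : (r : ℝ) = (u : ℝ) ^ 2 := by exact_mod_cast hru
      rw [hpu4]
      refine GPGraph.hasSpec_of_four_values hh hu3 hcd hc0 hd0 (by rw [hnr, hrR]; ring)
        (by rw [hrR]; ring) (by rw [hrR]; ring) (by rw [hrR]; ring) (by rw [hrR]; ring) ?_
      have hcast : ∀ (e x : ℤ), 4 * e = x → (e : ℂ) = (x : ℂ) / 4 := fun e x hx => by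
        rw [← hx]; push_cast; ring
      rw [hsum, hcast _ _ h1, hcast _ _ h2, hcast _ _ h3, hcast _ _ h5, hA', hB', hd₀]
      have hcast_r : ((r : ℝ) : ℂ) = ((r : ℤ) : ℂ) := by norm_cast
      push_cast
      -- Changing the sign of d swaps e₁ and e₂; changing that of c swaps e₃ and e₄.
      rcases sq_eq_sq_iff_eq_or_eq_neg.1 hcB with rfl | rfl <;>
        rcases sq_eq_sq_iff_eq_or_eq_neg.1 hdd with rfl | rfl <;>
        push_cast <;> ring_nf <;> abel_nf
  · replace hp3 : p % 4 = 3 := hp3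
    have hzero : A = 0 ∨ B = 0 := by
      refine GPGraph.eq_zero_of_sq_add_sq_eq_prime_pow hp hp3 s ?_
      rw [hAB, hr, Nat.cast_pow]
    have hrsq : ∀ {C : ℤ}, C ^ 2 = (r : ℤ) ^ 2 → C = r ∨ C = -r :=
      fun h => sq_eq_sq_iff_eq_or_eq_neg.1 h
    have hrs : r % 4 = 3 ^ s % 4 := by rw [hr, Nat.pow_mod, hp3]
    refine ⟨⟨s, by omega⟩, fun hm0 => ?_, fun hm2 => ?_⟩
    · replace hm0 : m % 4 = 0 := hm0
      obtain ⟨v, rfl⟩ : ∃ v, s = 2 * v := ⟨s / 2, by omega⟩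
      have hr4 : r % 4 = 1 := by rw [hrs, pow_mul, Nat.pow_mod]; simp
      -- B = 0 would give 4e₃ = -1 - r ≡ 2 (mod 4). With A = 0 and B = ±r, three of the four periods
      -- coincide.
      have hA0 : A = 0 := by
        refine hzero.resolve_right fun hB0 => ?_
        rcases hrsq (C := A) (by rw [← hAB, hB0]; ring) with hA | hA <;> omega
      have h21 : e₂ = e₁ := by linarith
      rcases hrsq (C := B) (by rw [← hAB, hA0]; ring) with hB | hB
      · refine GPGraph.hasSpec_of_two_periods hh hr3 hnr (a := e₁) (b := e₄)
          (by linarith) (by linarith) ?_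
        rw [hsum, h21, show e₃ = e₁ by linarith]
      · refine GPGraph.hasSpec_of_two_periods hh hr3 hnr (a := e₁) (b := e₃)
          (by linarith) (by linarith) ?_
        rw [hsum, h21, show e₄ = e₁ by linarith]
        ac_rfl
    · replace hm2 : m % 4 = 2 := hm2
      obtain ⟨v, rfl⟩ : ∃ v, s = 2 * v + 1 := ⟨s / 2, by omega⟩
      have hr4 : r % 4 = 3 := by rw [hrs, pow_succ, pow_mul, Nat.mul_mod, Nat.pow_mod]; simp
      -- Here A = 0 would give 4e₁ = r - 1 ≡ 2 (mod 4).
      have hB0 : B = 0 := by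
        refine hzero.resolve_left fun hA0 => ?_
        rcases hrsq (C := B) (by rw [← hAB, hA0]; ring) with hB | hB <;> omega
      have h43 : e₄ = e₃ := by linarith
      rcases hrsq (C := A) (by rw [← hAB, hB0]; ring) with hA | hA
      · refine GPGraph.hasSpec_of_two_periods' hh hr3 hnr (a := e₃) (b := e₁)
          (by linarith) (by linarith) ?_
        rw [hsum, h43, show e₂ = e₃ by linarith]
        ac_rfl
      · refine GPGraph.hasSpec_of_two_periods' hh hr3 hnr (a := e₃) (b := e₂)
          (by linarith) (by linarith) ?_
        rw [hsum, h43, show e₁ = e₃ by linarith]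
        ac_rfl
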